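/- **Definitions.** A *tract* $F=(G,N_G)$ is an abelian group $G$, written multiplicatively, together with a subset $N_G$ of the group semiring $\mathbb N[G]$ such that $0\in N_G$; $1\notin N_G$; there is a unique $\epsilon\in G$ with $1+\epsilon\in N_G$; and $N_G$ is closed under multiplication by elements of $G$. We write $F=G\cup\{0\}\subset\mathbb N[G]$, $F^\times=G$, $-1:=\epsilon$ and $-x:=\epsilon x$. Let $E$ be a finite non-empty set. The support of $X\in F^E$ is $\underline X=\{e\in E: X(e)\neq 0\}$. A *strong $F$-matroid* on $E$ is given by its set $\mathcal C\subseteq F^E$ of $F$-circuits, which satisfies: * (C0) $0\notin\mathcal C$. * (C1) If $X\in\mathcal C$ and $\alpha\in F^\times$, then $\alpha X\in\mathcal C$. * (C2) If $X,Y\in\mathcal C$ and $\underline X\subseteq\underline Y$, then $X=\alpha Y$ for some $\alpha\in F^\times$. * (C3) Let $X,X_1,\dots,X_k\in\mathcal C$ be a modular family of size $k+1$, i.e. their supports are distinct and the union of these supports has height $k+1$ in the lattice of all unions of supports of elements of $\mathcal C$ (ordered by inclusion). Suppose that $\underline X\not\subseteq\bigcup_{i}\underline{X_i}$ and that $e_1,\dots,e_k\in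 E$ are such that $e_i\in(\underline X\cap\underline{X_i})\setminus\bigcup_{j\ne i}\underline{X_j}$ and $X(e_i)=-X_i(e_i)\neq0$ for all $i$. Then there is $Z\in\mathcal C$ such that $Z(e_i)=0$ for all $i$ and $X_1(f)+\cdots+X_k(f)+X(f)-Z(f)\in N_G$ for all $f\in E$. The supports of the $F$-circuits of a strong $F$-matroid $M$ are the circuits of a matroid $\underline M$ on $E$, the *underlying matroid* of $M$. The *rank* of $M$ is the rank of $\underline M$. Let $r$ be a positive integer. A (strong) *Grassmann–Plücker function of rank $r$ on $E$ with coefficients in $F$* is a function $\varphi:E^r\to F$ such that: * (GP1) $\varphi$ is not identically zero. * (GP2) $\varphi$ is alternating: interchanging two arguments multiplies the value by $-1$, and $\varphi(x_1,\dots,x_r)=0$ if $x_i=x_j$ for some $i\ne j$. * (GP3) For all subsets $\{x_1,\dots,x_{r+1}\}$ and $\{y_1,\dots,y_{r-1}\}$ of $E$ (of sizes $r+1$ and $r-1$), $$\sum_{k=1}^{r+1}(-1)^k\,\varphi(x_1,\dots,\hat x_k,\dots,x_{r+1})\cdot\varphi(x_k,y_1,\dots,y_{r-1})\in N_G .$$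 The sets $\{x_1,\dots,x_r\}$ with $\varphi(x_1,\dots,x_r)\neq 0$ are the bases of a matroid $M_\varphi$ of rank $r$ on $E$. Two such functions $\varphi_1,\varphi_2$ are *equivalent* if $\varphi_1=g\cdot\varphi_2$ for some $g\in F^\times$. **Theorem.** Let $E$ be a non-empty finite set, let $F$ be a tract, and let $r$ be a positive integer. There is a bijection from the set of equivalence classes of Grassmann–Plücker functions of rank $r$ on $E$ with coefficients in $F$ to the set of strong $F$-matroids of rank $r$ on $E$ (defined by (C0)–(C3)) with the following explicit description. Let $\varphi$ be a Grassmann–Plücker function of rank $r$ on $E$, and let $\mathcal C$ be the set of $F$-circuits of the strong $F$-matroid $M$ that corresponds to the class of $\varphi$. Then $\underline M=M_\varphi$; and whenever $X\in F^E$ has as its support a circuit of $M_\varphi$, $x_0\in\underline X$, and $\{x_1,\dots,x_r\}$ is a basis of $M_\varphi$ that contains $\underline X\setminus\{x_0\}$, we have $X\in\mathcal C$ if and only if $$\frac{X(x_i)}{X(x_0)}=(-1)^i\,\frac{\varphi(x_0,\dots,\hat x_i,\dots,x_r)}{\varphi(x_1,\dots,x_r)}\qquad\text{for } i=1,\dots,r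 .$$ -/

import Mathlib

universe u v

noncomputable section

/-- A tract structure on a multiplicatively written abelian group `G`: a subset `N` of the group
semiring `ℕ[G]` (the "null set"), subject to the four tract axioms. The tract itself is
`F = G ∪ {0}`, for which we use `WithZero G`; its group of units `F^×` is `G`. -/
structure Tract (G : Type u) [CommGroup G] where
  /-- the null set `N_G ⊆ ℕ[G]` -/
  nullSet : Set (MonoidAlgebra ℕ G)
  zero_mem : 0 ∈ nullSet
  one_notMem : (1 : MonoidAlgebra ℕ G) ∉ nullSet
  existsUnique_eps : ∃! ε : G, 1 + MonoidAlgebra.of ℕ G ε ∈ nullSet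
  smul_mem : ∀ (g : G), ∀ a ∈ nullSet, MonoidAlgebra.of ℕ G g * a ∈ nullSet

namespace Tract

variable {G : Type u} [CommGroup G]

/-- The inclusion `F = G ∪ {0} ⊆ ℕ[G]`. -/
def formal : WithZero G →*₀ MonoidAlgebra ℕ G :=
  WithZero.lift' (MonoidAlgebra.of ℕ G)

/-- The unique element `ε` of `G` with `1 + ε ∈ N_G`; it plays the role of `-1`. -/
def eps (F : Tract G) : G := F.existsUnique_eps.choose

/-- Negation on `F = G ∪ {0}`: `-x := ε x`. -/
def neg (F : Tract G) (x : WithZero G) : WithZero G := (F.eps : WithZero G) * x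

/-- The sign `(-1)^k`, i.e. `ε ^ k`, as an element of `F`. -/
def sign (F : Tract G) (k : ℕ) : WithZero G := (F.eps : WithZero G) ^ k

theorem formal_coe (g : G) : formal (g : WithZero G) = MonoidAlgebra.of ℕ G g := by
  simp [formal]

theorem one_add_eps_mem (F : Tract G) : 1 + MonoidAlgebra.of ℕ G F.eps ∈ F.nullSet :=
  F.existsUnique_eps.choose_spec.1

theorem formal_mem_iff (F : Tract G) (x : WithZero G) : formal x ∈ F.nullSet ↔ x = 0 := by
  constructor
  · intro h
    induction x using WithZero.recZeroCoe with
    | zero => rfl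
    | coe g =>
      exfalso
      apply F.one_notMem
      have h2 := F.smul_mem g⁻¹ _ h
      rwa [formal_coe, ← map_mul, inv_mul_cancel, map_one] at h2
  · rintro rfl
    simpa using F.zero_mem

theorem neg_ne_zero_iff (F : Tract G) (x : WithZero G) : F.neg x ≠ 0 ↔ x ≠ 0 := by
  simp [neg]

end Tract

section Lattice

variable {E : Type v}

/-- The poset `U(S)` of all unions of members of a family `S` of subsets of `E`, ordered by
inclusion. It is a lattice, in which the join of two elements is their union. -/
def unionLattice (S : Set (Set E)) : Set (Set E) := {A | ∃ T ⊆ S, A = ⋃₀ T}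

theorem iUnion_mem_unionLattice {S : Set (Set E)} {ι : Type*} {A : ι → Set E}
    (hA : ∀ i, A i ∈ S) : (⋃ i, A i) ∈ unionLattice S :=
  ⟨Set.range A, by rintro _ ⟨i, rfl⟩; exact hA i, by rw [Set.sUnion_range]⟩

/-- A finite family of (distinct) members of `S` is modular if the height of its join (= union)
in the lattice `U(S)` equals the size of the family. (It is used only when the members of `S` are
nonempty and pairwise incomparable, so that they are atoms of `U(S)`.) -/
def IsModularFamily (S : Set (Set E)) {ι : Type*} [Fintype ι] (A : ι → Set E) : Prop :=
  Function.Injective A ∧ (∀ i, A i ∈ S) ∧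
    ∃ h : (⋃ i, A i) ∈ unionLattice S,
      Order.height (⟨⋃ i, A i, h⟩ : unionLattice S) = (Fintype.card ι : ℕ∞)

end Lattice

/-- A strong matroid on `E` over the tract `F`, given by its set of `F`-circuits.
The support of a vector `X ∈ F^E` is `Function.support X`. -/
structure StrongMatroid {G : Type u} [CommGroup G] (F : Tract G) (E : Type v) where
  /-- the set of `F`-circuits -/
  circuits : Set (E → WithZero G)
  /-- (C0) -/
  zero_notMem : (0 : E → WithZero G) ∉ circuits
  /-- (C1) -/
  smul_mem : ∀ X ∈ circuits, ∀ α : G, (fun e => (α : WithZero G) * X e) ∈ circuits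
  /-- (C2) -/
  incomparable : ∀ X ∈ circuits, ∀ Y ∈ circuits, Function.support X ⊆ Function.support Y →
    ∃ α : G, X = fun e => (α : WithZero G) * Y e
  /-- (C3), strong modular elimination; `Fin.cons X Xs` is the family `X, X₁, …, X_k` -/
  modular_elimination : ∀ (k : ℕ) (Xs : Fin k → E → WithZero G) (X : E → WithZero G)
    (e : Fin k → E), X ∈ circuits → (∀ i, Xs i ∈ circuits) →
    IsModularFamily (Function.support '' circuits)
      (Fin.cons (Function.support X) (fun i => Function.support (Xs i)) :
        Fin (k + 1) → Set E) →
    ¬ (Function.support X ⊆ ⋃ i, Function.support (Xs i)) →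
    (∀ i, ∀ j, j ≠ i → e i ∉ Function.support (Xs j)) →
    (∀ i, X (e i) = F.neg (Xs i (e i)) ∧ X (e i) ≠ 0) →
    ∃ Z ∈ circuits, (∀ i, Z (e i) = 0) ∧
      ∀ f, (∑ i, Tract.formal (Xs i f)) + Tract.formal (X f) + Tract.formal (F.neg (Z f))
        ∈ F.nullSet

namespace StrongMatroid

variable {G : Type u} [CommGroup G] {F : Tract G} {E : Type v}

/-- The supports of the `F`-circuits. -/
def supports (M : StrongMatroid F E) : Set (Set E) := Function.support '' M.circuits

theorem nonempty_of_mem_supports (M : StrongMatroid F E) {A : Set E} (hA : A ∈ M.supports) :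
    A.Nonempty := by
  obtain ⟨X, hX, rfl⟩ := hA
  rw [Function.support_nonempty_iff]
  rintro rfl
  exact M.zero_notMem hX

theorem eq_of_subset_of_mem_supports (M : StrongMatroid F E) {A B : Set E}
    (hA : A ∈ M.supports) (hB : B ∈ M.supports) (h : A ⊆ B) : A = B := by
  obtain ⟨X, hX, rfl⟩ := hA
  obtain ⟨Y, hY, rfl⟩ := hB
  obtain ⟨α, hα⟩ := M.incomparable X hX Y hY h
  rw [hα]
  ext e
  simp

/-- Circuit elimination for modular pairs of supports. -/
theorem modular_pair_elimination (M : StrongMatroid F E) {A B : Set E}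
    (hA : A ∈ M.supports) (hB : B ∈ M.supports) (hAB : A ≠ B)
    (h2 : Order.height (⟨A ∪ B, ⟨{A, B}, by
      rintro _ (rfl | rfl) <;> assumption, by simp⟩⟩ : unionLattice M.supports) = 2)
    {e : E} (heA : e ∈ A) (heB : e ∈ B) :
    ∃ C ∈ M.supports, C ⊆ (A ∪ B) \ {e} := by
  have hnot : ¬ A ⊆ B := fun h => hAB (M.eq_of_subset_of_mem_supports hA hB h)
  obtain ⟨X, hX, rfl⟩ := hA
  obtain ⟨Y, hY, rfl⟩ := hB
  -- rescale `Y` so that `X e = - Y e`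
  obtain ⟨g, hg⟩ := WithZero.ne_zero_iff_exists.1 (show X e ≠ 0 from heA)
  obtain ⟨g', hg'⟩ := WithZero.ne_zero_iff_exists.1 (show Y e ≠ 0 from heB)
  set a : G := F.eps⁻¹ * g * g'⁻¹ with ha
  set Y' : E → WithZero G := fun f => (a : WithZero G) * Y f with hY'
  have hsupp : Function.support Y' = Function.support Y := by
    ext f; simp [hY']
  have hXY : X e = F.neg (Y' e) := by
    simp only [hY', Tract.neg, ← hg, ← hg', ← WithZero.coe_mul, ha]
    congr 1
    group
  have hU : (⋃ i, (Fin.cons (Function.support X) (fun _ : Fin 1 => Function.support Y') :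
      Fin 2 → Set E) i) = Function.support X ∪ Function.support Y := by
    ext f
    simp [hsupp]
  obtain ⟨Z, hZ, hZe, hZN⟩ := M.modular_elimination 1 (fun _ => Y') X (fun _ => e) hX
    (fun _ => M.smul_mem Y hY a)
    (by
      refine ⟨?_, ?_, ?_⟩
      · intro i j hij
        fin_cases i <;> fin_cases j <;> simp [hsupp] at hij ⊢
        · exact hAB hij
        · exact hAB hij.symm
      · intro i
        fin_cases i
        · exact ⟨X, hX, rfl⟩
        · exact ⟨Y', M.smul_mem Y hY a, rfl⟩
      · refine ⟨?_, ?_⟩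
        · rw [hU]
          refine ⟨{Function.support X, Function.support Y}, ?_, by simp⟩
          rintro _ (rfl | rfl)
          · exact ⟨X, hX, rfl⟩
          · exact ⟨Y, hY, rfl⟩
        · simp only [hU]
          exact h2.trans (by simp))
    (by simpa [hsupp] using hnot)
    (fun i j hij => absurd (Subsingleton.elim j i) hij)
    (fun _ => ⟨hXY, heA⟩)
  refine ⟨_, ⟨Z, hZ, rfl⟩, ?_⟩
  intro f hf
  refine ⟨?_, ?_⟩
  · by_contra hcon
    simp only [Set.mem_union, Function.mem_support, not_or, not_not] at hcon
    have := hZN f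
    simp only [hY', hcon.1, hcon.2, mul_zero, map_zero, Finset.sum_const_zero, zero_add] at this
    rw [F.formal_mem_iff] at this
    exact (F.neg_ne_zero_iff _).2 hf this
  · rintro rfl
    exact hf (hZe 0)

/-- Circuit elimination for arbitrary pairs of supports. -/
theorem elimination [Finite E] (M : StrongMatroid F E) : ∀ (n : ℕ) {A B : Set E},
    A ∈ M.supports → B ∈ M.supports → A ≠ B → ∀ {e : E}, e ∈ A → e ∈ B → (A ∪ B).ncard = n →
    ∃ C ∈ M.supports, C ⊆ (A ∪ B) \ {e} := by
  intro n
  induction n using Nat.strong_induction_on with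
  | _ n ih =>
    intro A B hA hB hAB e heA heB hn
    have hmem : (A ∪ B) ∈ unionLattice M.supports :=
      ⟨{A, B}, by rintro _ (rfl | rfl) <;> assumption, by simp⟩
    by_cases h2 : Order.height (⟨A ∪ B, hmem⟩ : unionLattice M.supports) = 2
    · exact M.modular_pair_elimination hA hB hAB h2 heA heB
    -- the height is at least two
    have hempty : (∅ : Set E) ∈ unionLattice M.supports := ⟨∅, by simp, by simp⟩
    have hAm : A ∈ unionLattice M.supports := ⟨{A}, by simpa using hA, by simp⟩
    have hlt1 : (⟨∅, hempty⟩ : unionLattice M.supports) < ⟨A, hAm⟩ := by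
      rw [Subtype.mk_lt_mk]
      exact Set.empty_ssubset.2 (M.nonempty_of_mem_supports hA)
    have hlt2 : (⟨A, hAm⟩ : unionLattice M.supports) < ⟨A ∪ B, hmem⟩ := by
      rw [Subtype.mk_lt_mk]
      refine ⟨Set.subset_union_left, fun h => hAB ?_⟩
      exact (M.eq_of_subset_of_mem_supports hB hA (Set.subset_union_right.trans h)).symm
    have hge2 : (2 : ℕ∞) ≤ Order.height (⟨A ∪ B, hmem⟩ : unionLattice M.supports) := by
      have h1 := Order.height_add_one_le hlt1
      have h1' := Order.height_add_one_le hlt2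
      calc (2 : ℕ∞) = 0 + 1 + 1 := by norm_num
        _ ≤ _ := le_trans (by gcongr; exact le_trans (by gcongr; exact zero_le) h1) h1'
    have hge3 : ((3 : ℕ) : ℕ∞) ≤ Order.height (⟨A ∪ B, hmem⟩ : unionLattice M.supports) := by
      have hlt : (2 : ℕ∞) < Order.height (⟨A ∪ B, hmem⟩ : unionLattice M.supports) :=
        lt_of_le_of_ne hge2 (Ne.symm h2)
      have := Order.add_one_le_of_lt hlt
      calc ((3 : ℕ) : ℕ∞) = 2 + 1 := by norm_num
        _ ≤ _ := this
    obtain ⟨p, hlast, hlen⟩ := Order.exists_series_of_le_height _ hge3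
    have hp : ∀ i j : Fin (p.length + 1), i < j → (p i).1 ⊂ (p j).1 :=
      fun i j hij => p.strictMono hij
    set i0 : Fin (p.length + 1) := ⟨0, by omega⟩
    set i1 : Fin (p.length + 1) := ⟨1, by omega⟩
    set i2 : Fin (p.length + 1) := ⟨2, by omega⟩
    set i3 : Fin (p.length + 1) := ⟨3, by omega⟩
    have h01 := hp i0 i1 (Fin.mk_lt_mk.2 (by norm_num))
    have h12 := hp i1 i2 (Fin.mk_lt_mk.2 (by norm_num))
    have h23 := hp i2 i3 (Fin.mk_lt_mk.2 (by norm_num))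
    have h3 : (p i3).1 = A ∪ B := by
      have : i3 = Fin.last _ := Fin.ext (by simp [i3, hlen])
      rw [this]
      exact congrArg Subtype.val hlast
    obtain ⟨T1, hT1, hT1'⟩ := (p i1).2
    obtain ⟨T2, hT2, hT2'⟩ := (p i2).2
    obtain ⟨x, hx, -⟩ := Set.exists_of_ssubset h01
    obtain ⟨y, hy, hy'⟩ := Set.exists_of_ssubset h12
    rw [hT1'] at hx
    obtain ⟨C, hC, hxC⟩ := hx
    have hy2 := hy
    rw [hT2'] at hy2
    obtain ⟨D, hD, hyD⟩ := hy2
    have hC1 : C ⊆ (p i1).1 := by rw [hT1']; exact Set.subset_sUnion_of_mem hC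
    have hD2 : D ⊆ (p i2).1 := by rw [hT2']; exact Set.subset_sUnion_of_mem hD
    have hCD : C ≠ D := by rintro rfl; exact hy' (hC1 hyD)
    have hsub : C ∪ D ⊂ A ∪ B := by
      rw [← h3]
      exact lt_of_le_of_lt (Set.union_subset (hC1.trans h12.1) hD2) h23
    by_cases heC : e ∈ C
    · by_cases heD : e ∈ D
      · obtain ⟨Z, hZ, hZs⟩ := ih (C ∪ D).ncard
          (hn ▸ Set.ncard_lt_ncard hsub (Set.toFinite _)) (hT1 hC) (hT2 hD) hCD heC heD rfl
        exact ⟨Z, hZ, hZs.trans (Set.sdiff_subset_sdiff_left hsub.1)⟩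
      · refine ⟨D, hT2 hD, fun f hf => ⟨hsub.1 (Or.inr hf), ?_⟩⟩
        rintro rfl
        exact heD hf
    · refine ⟨C, hT1 hC, fun f hf => ⟨hsub.1 (Or.inl hf), ?_⟩⟩
      rintro rfl
      exact heC hf

/-- Augmentation for the sets containing no support of an `F`-circuit. -/
theorem augmentation [Finite E] (M : StrongMatroid F E) {I J : Set E}
    (hI : ∀ C ∈ M.supports, ¬ C ⊆ I) (hJ : ∀ C ∈ M.supports, ¬ C ⊆ J)
    (hIJ : I.ncard < J.ncard) :
    ∃ e ∈ J, e ∉ I ∧ ∀ C ∈ M.supports, ¬ C ⊆ insert e I := by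
  classical
  let P : ℕ → Prop := fun m => ∃ K : Set E, K ⊆ I ∪ J ∧ (∀ C ∈ M.supports, ¬ C ⊆ K) ∧
    I.ncard < K.ncard ∧ (I \ K).ncard = m
  have hP : ∃ m, P m := ⟨_, J, Set.subset_union_right, hJ, hIJ, rfl⟩
  obtain ⟨K, hKIJ, hK, hIK, hm⟩ := Nat.find_spec hP
  have hmin : ∀ K' : Set E, K' ⊆ I ∪ J → I.ncard < K'.ncard →
      (I \ K').ncard < (I \ K).ncard → ∃ C ∈ M.supports, C ⊆ K' := by
    intro K' h1 h2 h3
    by_contra hcon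
    push Not at hcon
    exact Nat.find_min hP (hm ▸ h3) ⟨K', h1, hcon, h2, rfl⟩
  obtain ⟨g, hgK, hgI⟩ : ∃ g ∈ K, g ∉ I := by
    by_contra hcon
    push Not at hcon
    exact absurd (Set.ncard_le_ncard hcon (Set.toFinite _)) (not_le.2 hIK)
  by_cases hsub : I ⊆ K
  · refine ⟨g, (hKIJ hgK).resolve_left hgI, hgI, fun C hC hCI => hK C hC ?_⟩
    exact hCI.trans (Set.insert_subset hgK hsub)
  exfalso
  obtain ⟨e, heI, heK⟩ := Set.not_subset.1 hsub
  have key : ∀ f ∈ K, f ∉ I → ∃ C ∈ M.supports, C ⊆ insert e (K \ {f}) := by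
    intro f hfK hfI
    apply hmin
    · exact Set.insert_subset (Or.inl heI) (Set.sdiff_subset.trans hKIJ)
    · rw [Set.ncard_exchange heK hfK]
      exact hIK
    · refine Set.ncard_lt_ncard ⟨?_, ?_⟩ (Set.toFinite _)
      · rintro a ⟨haI, haK⟩
        refine ⟨haI, fun h => haK (Or.inr ⟨h, ?_⟩)⟩
        rintro rfl
        exact hfI haI
      · intro h
        exact (h ⟨heI, heK⟩).2 (Or.inl rfl)
  have hemem : ∀ f C, C ∈ M.supports → C ⊆ insert e (K \ {f}) → e ∈ C := by
    intro f C hC hCs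
    by_contra he
    refine hK C hC fun a ha => ?_
    rcases hCs ha with rfl | h
    · exact absurd ha he
    · exact h.1
  obtain ⟨C, hC, hCs⟩ := key g hgK hgI
  obtain ⟨h, hhC, hhI⟩ : ∃ h ∈ C, h ∉ I := Set.not_subset.1 (hI C hC)
  have hhK : h ∈ K := by
    rcases hCs hhC with rfl | h'
    · exact absurd heI hhI
    · exact h'.1
  obtain ⟨D, hD, hDs⟩ := key h hhK hhI
  have hCD : C ≠ D := by
    rintro rfl
    rcases hDs hhC with rfl | h'
    · exact hhI heI
    · exact h'.2 rfl
  obtain ⟨Z, hZ, hZs⟩ := M.elimination _ hC hD hCD (hemem g C hC hCs) (hemem h D hD hDs) rfl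
  refine hK Z hZ fun a ha => ?_
  obtain ⟨hau, hae⟩ := hZs ha
  rcases hau with h' | h'
  · exact ((hCs h').resolve_left hae).1
  · exact ((hDs h').resolve_left hae).1

/-- The underlying matroid of a strong `F`-matroid, in terms of its independent sets: they are the
sets containing no support of an `F`-circuit. -/
def indepMatroid [Finite E] (M : StrongMatroid F E) : IndepMatroid E :=
  IndepMatroid.ofFinite (E := Set.univ) Set.finite_univ
    (fun I => ∀ C ∈ M.supports, ¬ C ⊆ I)
    (fun _ hC h => (M.nonempty_of_mem_supports hC).ne_empty (Set.subset_empty_iff.1 h))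
    (fun _ _ hJ hIJ C hC h => hJ C hC (h.trans hIJ))
    (fun _ _ hI hJ hIJ => M.augmentation hI hJ hIJ)
    (fun _ _ => Set.subset_univ _)

/-- The underlying matroid of a strong `F`-matroid: the matroid on `E` whose circuits are the
supports of the `F`-circuits. -/
def underlying [Finite E] (M : StrongMatroid F E) : Matroid E := M.indepMatroid.matroid

theorem underlying_ground [Finite E] (M : StrongMatroid F E) : M.underlying.E = Set.univ := rfl

theorem underlying_indep_iff [Finite E] (M : StrongMatroid F E) {I : Set E} :
    M.underlying.Indep I ↔ ∀ C ∈ M.supports, ¬ C ⊆ I := by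
  simp [underlying, indepMatroid, IndepMatroid.ofFinite, IndepMatroid.ofBddAugment,
    IndepMatroid.ofBdd]

/-- The circuits of the underlying matroid are exactly the supports of the `F`-circuits. -/
theorem underlying_isCircuit_iff [Finite E] (M : StrongMatroid F E) {C : Set E} :
    M.underlying.IsCircuit C ↔ ∃ X ∈ M.circuits, Function.support X = C := by
  change _ ↔ C ∈ M.supports
  rw [Matroid.isCircuit_iff_minimal_not_indep (Set.subset_univ _)]
  constructor
  · intro h
    have h1 := h.prop
    rw [underlying_indep_iff] at h1
    push Not at h1
    obtain ⟨D, hD, hDC⟩ := h1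
    have hD' : ¬ M.underlying.Indep D := by
      rw [underlying_indep_iff]
      exact fun h' => h' D hD le_rfl
    rwa [← h.eq_of_subset hD' hDC]
  · intro hC
    refine ⟨?_, ?_⟩
    · change ¬ M.underlying.Indep C
      rw [underlying_indep_iff]
      exact fun h' => h' C hC le_rfl
    · intro D hD hDC
      rw [underlying_indep_iff] at hD
      push Not at hD
      obtain ⟨C', hC', hC'D⟩ := hD
      rw [← M.eq_of_subset_of_mem_supports hC' hC (hC'D.trans hDC)]
      exact hC'D

/-- The rank of a strong `F`-matroid is the rank of its underlying matroid. -/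
def rank [Finite E] (M : StrongMatroid F E) : ℕ∞ := M.underlying.eRank

end StrongMatroid

/-- A strong Grassmann–Plücker function of rank `r = n + 1` on `E` with coefficients in the tract
`F`. (Ranks are positive, whence the parameter `n = r - 1`.) -/
structure GPFunction {G : Type u} [CommGroup G] (F : Tract G) (E : Type v) (n : ℕ) where
  /-- the function `φ : E^r → F` -/
  toFun : (Fin (n + 1) → E) → WithZero G
  /-- (GP1) `φ` is not identically zero -/
  exists_ne_zero : ∃ x, toFun x ≠ 0
  /-- (GP2) interchanging two arguments changes the sign -/
  map_swap : ∀ x i j, i ≠ j → toFun (x ∘ Equiv.swap i j) = F.neg (toFun x)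
  /-- (GP2) `φ` vanishes if two arguments agree -/
  map_eq_zero : ∀ x i j, i ≠ j → x i = x j → toFun x = 0
  /-- (GP3) the Grassmann–Plücker relations for `{x₁, …, x_{r+1}}` and `{y₁, …, y_{r-1}}`. The
  index `k : Fin (n + 2)` stands for the index `k + 1` of the usual 1-based enumeration;
  `x ∘ k.succAbove` is `x` with the entry at `k` omitted. -/
  relation : ∀ (x : Fin (n + 2) → E) (y : Fin n → E),
    Function.Injective x → Function.Injective y →
    ∑ k : Fin (n + 2), Tract.formal (F.sign ((k : ℕ) + 1) *
      (toFun (x ∘ k.succAbove) * toFun (Fin.cons (x k) y))) ∈ F.nullSet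

namespace GPFunction

variable {G : Type u} [CommGroup G] {F : Tract G} {E : Type v} {n : ℕ}

theorem injective_of_ne_zero (φ : GPFunction F E n) {x : Fin (n + 1) → E}
    (hx : φ.toFun x ≠ 0) : Function.Injective x := by
  intro i j hij
  by_contra hne
  exact hx (φ.map_eq_zero x i j hne hij)

/-- A set is in the support `B_φ` of `φ` if it is `{x₁, …, x_r}` for some `x` with `φ(x) ≠ 0`. -/
def IsBase (φ : GPFunction F E n) (B : Set E) : Prop :=
  ∃ x, φ.toFun x ≠ 0 ∧ Set.range x = B

theorem exchange (φ : GPFunction F E n) : Matroid.ExchangeProperty φ.IsBase := by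
  rintro _ _ ⟨x, hx, rfl⟩ ⟨y, hy, rfl⟩ a ⟨⟨i, rfl⟩, hay⟩
  -- move the element to be exchanged to the front
  obtain ⟨x', hx', hr, h0⟩ : ∃ x', φ.toFun x' ≠ 0 ∧ Set.range x' = Set.range x ∧ x' 0 = x i := by
    refine ⟨x ∘ Equiv.swap 0 i, ?_, ?_, by simp⟩
    · by_cases h : 0 = i
      · subst h; simpa using hx
      · rw [φ.map_swap x 0 i h]
        exact (F.neg_ne_zero_iff _).2 hx
    · exact (Equiv.swap 0 i).surjective.range_comp x
  rw [← hr]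
  rw [← h0] at hay ⊢
  have hinj' := φ.injective_of_ne_zero hx'
  have hinj := φ.injective_of_ne_zero hy
  have hrel := φ.relation (Fin.cons (x' 0) y) (Fin.tail x')
    (Fin.cons_injective_iff.2 ⟨hay, hinj⟩)
    (fun i j h => Fin.succ_injective _ (hinj' h))
  obtain ⟨k, hk⟩ : ∃ k : Fin (n + 1), φ.toFun (Fin.cons (y k) (Fin.tail x')) ≠ 0 := by
    by_contra hcon
    push Not at hcon
    rw [Fin.sum_univ_succ] at hrel
    simp only [Fin.cons_succ, hcon, mul_zero, map_zero, Finset.sum_const_zero, add_zero,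
      Fin.cons_zero, Fin.cons_self_tail] at hrel
    rw [F.formal_mem_iff] at hrel
    have hcomp : (Fin.cons (x' 0) y : Fin (n + 2) → E) ∘ (0 : Fin (n + 2)).succAbove = y := by
      ext j; simp
    rw [hcomp] at hrel
    simp [Tract.sign, hx', hy] at hrel
  have hinjk := φ.injective_of_ne_zero hk
  have hb := (Fin.cons_injective_iff.1 hinjk).1
  refine ⟨y k, ⟨⟨k, rfl⟩, ?_⟩, _, hk, ?_⟩
  · rintro ⟨j, hj⟩
    induction j using Fin.cases with
    | zero => exact hay ⟨k, hj.symm⟩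
    | succ j => exact hb ⟨j, hj⟩
  · rw [Fin.range_cons]
    congr 1
    ext f
    constructor
    · rintro ⟨j, rfl⟩
      refine ⟨⟨j.succ, rfl⟩, fun h => ?_⟩
      exact absurd (hinj' h) (Fin.succ_ne_zero j)
    · rintro ⟨⟨j, rfl⟩, hj⟩
      induction j using Fin.cases with
      | zero => exact absurd rfl hj
      | succ j => exact ⟨j, rfl⟩

/-- The underlying matroid `M_φ` of `φ`: the matroid on `E` whose set of bases is the support of
`φ`. -/
def underlying [Finite E] (φ : GPFunction F E n) : Matroid E :=
  Matroid.ofIsBaseOfFinite (E := Set.univ) Set.finite_univ φ.IsBase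
    (let ⟨x, hx⟩ := φ.exists_ne_zero; ⟨_, x, hx, rfl⟩) φ.exchange (fun _ _ => Set.subset_univ _)

theorem underlying_isBase_iff [Finite E] (φ : GPFunction F E n) {B : Set E} :
    φ.underlying.IsBase B ↔ ∃ x, φ.toFun x ≠ 0 ∧ Set.range x = B := Iff.rfl

/-- Two Grassmann–Plücker functions are equivalent if they differ by a factor in `F^× = G`. -/
def equivalence (F : Tract G) (E : Type v) (n : ℕ) : Setoid (GPFunction F E n) where
  r φ ψ := ∃ g : G, ∀ x, φ.toFun x = (g : WithZero G) * ψ.toFun x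
  iseqv :=
    { refl := fun φ => ⟨1, by simp⟩
      symm := by
        rintro φ ψ ⟨g, hg⟩
        refine ⟨g⁻¹, fun x => ?_⟩
        rw [hg x, ← mul_assoc, ← WithZero.coe_mul]
        simp
      trans := by
        rintro φ ψ χ ⟨g, hg⟩ ⟨h, hh⟩
        refine ⟨g * h, fun x => ?_⟩
        rw [hg x, hh x, WithZero.coe_mul, mul_assoc] }

end GPFunction

/-- Equivalence classes of Grassmann–Plücker functions of rank `n + 1`. -/
abbrev GPClass {G : Type u} [CommGroup G] (F : Tract G) (E : Type v) (n : ℕ) :=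
  Quotient (GPFunction.equivalence F E n)

end

open Set

/-! ### Arithmetic of tracts and antisymmetric functions of tuples -/

namespace Tract

variable {G : Type u} [CommGroup G] (F : Tract G)

/-! From `φ` to circuits. The circuits attached to `φ` are the vectors supported on circuits of
`M_φ` that are orthogonal to every `φ(·, y)`: the formal sum of the `X(e) φ(e, y)` is null for all
`y`. A two-term sum is null exactly when its terms are negatives of each other, so a `y` that kills
all but two coordinates of `X` yields the coordinate formula and uniqueness up to scaling. GP3 says
that the signed minors of an `(r+1)`-tuple form an orthogonal vector, which gives existence. For
(C3), removing one private point from each member of a modular family leaves an independent set `B`.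
The circuit `Z` is a multiple of the fundamental circuit over `B` of the private point of `X`, and a
suitable `y` turns the required relation at `f ∈ B` into the orthogonality of `X`
(`modular_elimination_circuitSet`).

From circuits to `φ`. The circuits of `M` prescribe the ratios of the values of `φ` on adjacent
bases (`IsCompatible`), and these prescriptions must be shown consistent. This is done for the
contractions of `M` by independent sets `K`, by induction on the corank of `K`. In corank one,
consistency is elimination between two circuits. In higher corank, each contraction by a further
element `e` has a function `φ e`, unique up to a scalar (`IsCompatible.exists_eq_mul`). Comparing `φ
e` with `φ f` for independent pairs gives a factor `κ e f` on the edges of a complete multipartite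
graph whose parts are the parallel classes. On such a graph triangles and squares generate all cycle
conditions (`exists_potential_of_multipartite`). These hold for `κ` (`exists_scaling`), so the `φ e`
can be rescaled to glue (`exists_isCompatible_succ`).

Simultaneous elimination of many elements then shows that the circuits of `M` are orthogonal to all
`φ(·, y)` (`IsCompatible.sum_mem`). Since the signed minors of a tuple are proportional to a
circuit, GP3 follows, and so does the fact that `φ` gives back `M`. Uniqueness of compatible
functions for `K = ∅` is injectivity. -/

theorem eps_mul_eps : (F.eps : WithZero G) * (F.eps : WithZero G) = 1 := by
  -- Scaling `1 + ε` by `ε⁻¹` makes `ε⁻¹` a second solution, so uniqueness forces `ε⁻¹ = ε`.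
  have h : 1 + MonoidAlgebra.of ℕ G F.eps⁻¹ ∈ F.nullSet := by
    have := F.smul_mem F.eps⁻¹ _ F.one_add_eps_mem
    rwa [mul_add, mul_one, ← map_mul, inv_mul_cancel, map_one, add_comm] at this
  have h2 : F.eps⁻¹ = F.eps := F.existsUnique_eps.unique h F.one_add_eps_mem
  rw [← WithZero.coe_mul]
  nth_rw 1 [← h2]
  simp

theorem eps_ne_zero : (F.eps : WithZero G) ≠ 0 := WithZero.coe_ne_zero

theorem eps_mul_eps_mul (a : WithZero G) : (F.eps : WithZero G) * (F.eps * a) = a := by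
  rw [← mul_assoc, eps_mul_eps, one_mul]

@[simp]
theorem neg_neg (a : WithZero G) : F.neg (F.neg a) = a := F.eps_mul_eps_mul a

theorem eq_neg_comm {a b : WithZero G} : a = F.neg b ↔ b = F.neg a :=
  ⟨fun h => by rw [h, neg_neg], fun h => by rw [h, neg_neg]⟩

theorem formal_mul_mem (α : WithZero G) {a : MonoidAlgebra ℕ G} (ha : a ∈ F.nullSet) :
    formal α * a ∈ F.nullSet := by
  induction α using WithZero.recZeroCoe with
  | zero => simpa using F.zero_mem
  | coe g => rw [formal_coe]; exact F.smul_mem g a ha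

theorem formal_mul_mem_iff {α : WithZero G} (hα : α ≠ 0) {a : MonoidAlgebra ℕ G} :
    formal α * a ∈ F.nullSet ↔ a ∈ F.nullSet := by
  refine ⟨fun h => ?_, F.formal_mul_mem α⟩
  have := F.formal_mul_mem α⁻¹ h
  rwa [← mul_assoc, ← map_mul, inv_mul_cancel₀ hα, map_one, one_mul] at this

/-- Dividing by `a` reduces to `1 + g`, where the uniqueness of `ε` applies; `b = 0` is excluded by
`1 ∉ N`. This is what turns two-term null relations into equations. -/
theorem formal_add_formal_mem_iff (a b : WithZero G) :
    formal a + formal b ∈ F.nullSet ↔ a = F.neg b := by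
  by_cases ha : a = 0
  · subst ha
    rw [map_zero, zero_add, formal_mem_iff, eq_neg_comm]
    simp [neg]
  rw [eq_neg_comm]
  have key : formal a + formal b = formal a * (1 + formal (a⁻¹ * b)) := by
    rw [mul_add, mul_one, ← map_mul, mul_inv_cancel_left₀ ha]
  rw [key, F.formal_mul_mem_iff ha]
  constructor
  · intro h
    have hb : a⁻¹ * b ≠ 0 := by
      intro h0
      rw [h0, map_zero, add_zero] at h
      exact F.one_notMem h
    obtain ⟨g, hg⟩ := WithZero.ne_zero_iff_exists.1 hb
    rw [← hg, formal_coe] at h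
    have := F.existsUnique_eps.unique h F.one_add_eps_mem
    rw [this, eq_inv_mul_iff_mul_eq₀ ha] at hg
    rw [← hg, neg, mul_comm]
  · rintro rfl
    rw [neg, mul_left_comm, inv_mul_cancel₀ ha, mul_one, formal_coe]
    exact F.one_add_eps_mem

theorem sign_ne_zero (k : ℕ) : F.sign k ≠ 0 := pow_ne_zero _ F.eps_ne_zero

theorem sign_mul_sign (k : ℕ) : F.sign k * F.sign k = 1 := by
  rw [sign, ← mul_pow, eps_mul_eps, one_pow]

theorem sign_succ (k : ℕ) : F.sign (k + 1) = F.eps * F.sign k := pow_succ' _ _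

theorem support_coe_mul {E : Type v} (X : E → WithZero G) (α : G) :
    Function.support (fun e => (α : WithZero G) * X e) = Function.support X := by
  ext e; simp

/-- A function of tuples is antisymmetric: interchanging two arguments changes
the sign. -/
def IsAntisymm {E : Type v} {m : ℕ} (f : (Fin m → E) → WithZero G) : Prop :=
  ∀ x i j, i ≠ j → f (x ∘ Equiv.swap i j) = F.neg (f x)

variable {F} {E : Type v} {m : ℕ}

/-- Moving the `i`-th argument to the front. -/
theorem IsAntisymm.cons_succAbove {f : (Fin (m + 1) → E) → WithZero G} (hf : F.IsAntisymm f)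
    (x : Fin (m + 1) → E) (i : Fin (m + 1)) :
    f (Fin.cons (x i) (x ∘ i.succAbove)) = F.sign i * f x := by
  induction i using Fin.induction generalizing x with
  | zero =>
    have : (Fin.cons (x 0) (x ∘ (0 : Fin (m + 1)).succAbove) : Fin (m + 1) → E) = x := by
      ext j; refine Fin.cases ?_ (fun j => ?_) j <;> simp
    rw [this]; simp [sign]
  | succ i ih =>
    -- After an adjacent transposition the chosen entry sits one place further left and the
    -- remaining entries are unchanged, at the cost of one `ε`.
    have h := ih (x ∘ Equiv.swap i.castSucc i.succ)
    have h1 : (x ∘ Equiv.swap i.castSucc i.succ) ∘ i.castSucc.succAbove =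
        x ∘ i.succ.succAbove := by
      ext j
      simp only [Function.comp]
      congr 1
      simp only [Fin.succAbove, Equiv.swap_apply_def, Fin.lt_def, Fin.ext_iff]
      split_ifs <;> simp_all <;> omega
    rw [h1, hf _ _ _ (by simp [Fin.ext_iff])] at h
    rw [Function.comp_apply, Equiv.swap_apply_left] at h
    rw [h, Fin.val_succ, sign_succ, neg, Fin.val_castSucc, mul_left_comm, mul_assoc]

/-- Antisymmetry follows from antisymmetry in all arguments but the first, and in the first two. -/
theorem IsAntisymm.of_cons {f : (Fin (m + 2) → E) → WithZero G}
    (h1 : ∀ e, F.IsAntisymm fun x : Fin (m + 1) → E => f (Fin.cons e x))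
    (h2 : ∀ e e' x, f (Fin.cons e (Fin.cons e' x)) = F.neg (f (Fin.cons e' (Fin.cons e x)))) :
    F.IsAntisymm f := by
  have hsucc : ∀ x (i j : Fin (m + 1)), i ≠ j →
      f (x ∘ Equiv.swap i.succ j.succ) = F.neg (f x) := by
    intro x i j hij
    have := h1 (x 0) (Fin.tail x) i j hij
    simp only [Fin.cons_self_tail] at this
    rw [← this]
    congr 1
    ext k
    refine Fin.cases ?_ (fun k => ?_) k
    · rw [Function.comp_apply, Equiv.swap_apply_of_ne_of_ne (Fin.succ_ne_zero i).symm
        (Fin.succ_ne_zero j).symm, Fin.cons_zero]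
    · simp only [Function.comp, Fin.cons_succ, Fin.tail]
      congr 1
      simp only [Equiv.swap_apply_def, Fin.succ_inj]
      split_ifs <;> rfl
  have h01 : ∀ x, f (x ∘ Equiv.swap 0 1) = F.neg (f x) := by
    intro x
    have e1 : x = Fin.cons (x 0) (Fin.cons (x 1) (Fin.tail (Fin.tail x))) := by
      ext k
      refine Fin.cases ?_ (fun k => ?_) k
      · simp
      · refine Fin.cases ?_ (fun k => ?_) k <;> simp [Fin.tail]
    have e2 : x ∘ Equiv.swap 0 1 = Fin.cons (x 1) (Fin.cons (x 0) (Fin.tail (Fin.tail x))) := by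
      ext k
      refine Fin.cases ?_ (fun k => ?_) k
      · simp
      · refine Fin.cases ?_ (fun k => ?_) k
        · simp
        · simp [Fin.tail, Equiv.swap_apply_def, Fin.ext_iff]
    rw [e2, h2, ← e1]
  have hzero : ∀ x (j : Fin (m + 1)), f (x ∘ Equiv.swap 0 j.succ) = F.neg (f x) := by
    intro x j
    by_cases hj : j = 0
    · subst hj; exact h01 x
    -- Conjugation `(0 j) = (1 j)(0 1)(1 j)`: three transpositions already treated, hence an odd
    -- number of signs.
    · have e : x ∘ Equiv.swap 0 j.succ =
          ((x ∘ Equiv.swap (Fin.succ 0) j.succ) ∘ Equiv.swap 0 1) ∘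
            Equiv.swap (Fin.succ 0) j.succ := by
        ext k
        simp only [Function.comp]
        congr 1
        rw [← Equiv.Perm.mul_apply, ← Equiv.Perm.mul_apply]
        have : Equiv.swap (0 : Fin (m + 2)) j.succ =
            Equiv.swap (Fin.succ 0) j.succ * Equiv.swap 0 (Fin.succ 0) *
              Equiv.swap (Fin.succ 0) j.succ := by
          rw [Equiv.swap_mul_swap_mul_swap (Fin.succ_ne_zero 0).symm (Fin.succ_ne_zero j).symm,
            Equiv.swap_comm]
        rw [this]; rfl
      rw [e, hsucc _ _ _ (Ne.symm hj), h01, hsucc _ _ _ (Ne.symm hj), neg_neg]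
  intro x i j hij
  induction i using Fin.cases with
  | zero =>
    induction j using Fin.cases with
    | zero => exact absurd rfl hij
    | succ j => exact hzero x j
  | succ i =>
    induction j using Fin.cases with
    | zero => rw [Equiv.swap_comm]; exact hzero x i
    | succ j => exact hsucc x i j (fun h => hij (congrArg _ h))

end Tract

/-! ### Height in the lattice of unions versus nullity -/

section Height

variable {E : Type v} {S : Set (Set E)}

theorem union_mem_unionLattice {A B : Set E} (hA : A ∈ unionLattice S)
    (hB : B ∈ unionLattice S) : A ∪ B ∈ unionLattice S := by
  obtain ⟨T, hT, rfl⟩ := hA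
  obtain ⟨T', hT', rfl⟩ := hB
  exact ⟨T ∪ T', union_subset hT hT', by rw [sUnion_union]⟩

theorem mem_unionLattice_of_mem {A : Set E} (hA : A ∈ S) : A ∈ unionLattice S :=
  ⟨{A}, by simpa using hA, by simp⟩

theorem empty_mem_unionLattice : ∅ ∈ unionLattice S := ⟨∅, by simp, by simp⟩

/-- Each set with a private point adds at least one to the height. -/
theorem height_add_le_height_union {A : Set E} (hA : A ∈ unionLattice S) :
    ∀ (m : ℕ) (C : Fin m → Set E) (p : Fin m → E), (∀ i, C i ∈ S) → (∀ i, p i ∈ C i) →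
      (∀ i, p i ∉ A) → (∀ i j, i < j → p i ∉ C j) →
      ∀ hU : A ∪ ⋃ i, C i ∈ unionLattice S,
        Order.height (⟨A, hA⟩ : unionLattice S) + m ≤
          Order.height (⟨A ∪ ⋃ i, C i, hU⟩ : unionLattice S) := by
  intro m
  induction m with
  | zero =>
    intro C p _ _ _ _ hU
    simp
  | succ m ih =>
    intro C p hC hp hpA hpC hU
    have hU' : A ∪ ⋃ i : Fin m, C i.succ ∈ unionLattice S :=
      union_mem_unionLattice hA (iUnion_mem_unionLattice fun i => hC i.succ)
    have h := ih (fun i => C i.succ) (fun i => p i.succ) (fun i => hC _) (fun i => hp _)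
      (fun i => hpA _) (fun i j hij => hpC _ _ (Fin.succ_lt_succ_iff.2 hij)) hU'
    -- `p 0` lies neither in `A` nor in any later set, so restoring `C 0` enlarges the union
    -- strictly. Only later sets need to avoid a point, hence the triangular hypothesis.
    have hlt : (⟨_, hU'⟩ : unionLattice S) < ⟨A ∪ ⋃ i, C i, hU⟩ := by
      rw [Subtype.mk_lt_mk]
      refine ⟨union_subset_union_right _ (iUnion_subset fun i => subset_iUnion C i.succ),
        fun hsub => ?_⟩
      have h0 : p 0 ∈ A ∪ ⋃ i : Fin m, C i.succ :=
        hsub (Or.inr (mem_iUnion.2 ⟨0, hp 0⟩))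
      rcases h0 with h0 | h0
      · exact hpA 0 h0
      · obtain ⟨i, hi⟩ := mem_iUnion.1 h0
        exact hpC 0 i.succ (Fin.succ_pos i) hi
    calc _ = Order.height (⟨A, hA⟩ : unionLattice S) + m + 1 := by push_cast; rw [add_assoc]
      _ ≤ Order.height (⟨_, hU'⟩ : unionLattice S) + 1 := by gcongr
      _ ≤ _ := Order.height_add_one_le hlt

/-- Among unions of circuits the nullity is strictly increasing. -/
theorem Matroid.eRk_add_encard_lt_of_ssubset [Finite E] (N : Matroid E)
    (hS : ∀ C ∈ S, N.IsCircuit C) {A B : Set E} (hB : B ∈ unionLattice S) (hAB : A ⊂ B) :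
    N.eRk B + A.encard < N.eRk A + B.encard := by
  obtain ⟨g, hgB, hgA⟩ := exists_of_ssubset hAB
  obtain ⟨T, hT, rfl⟩ := hB
  obtain ⟨C, hC, hgC⟩ := hgB
  -- A circuit through `g` inside the larger set shows that deleting `g` keeps the rank while the
  -- size drops; this is the source of strictness.
  have hcl : g ∈ N.closure (⋃₀ T \ {g}) :=
    N.closure_subset_closure (sdiff_subset_sdiff_left (subset_sUnion_of_mem hC))
      ((hS C (hT hC)).mem_closure_sdiff_singleton_of_mem hgC)
  have h1 : N.eRk (⋃₀ T) = N.eRk (⋃₀ T \ {g}) := by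
    rw [← N.eRk_closure_eq, ← Matroid.closure_sdiff_singleton_eq_closure hcl, N.eRk_closure_eq]
  have hsub : A ⊆ ⋃₀ T \ {g} := fun a ha => ⟨hAB.1 ha, by rintro rfl; exact hgA ha⟩
  have h2 := N.eRk_le_eRk_add_eRk_sdiff hsub
  have h3 := N.eRk_le_encard ((⋃₀ T \ {g}) \ A)
  have h4 := encard_sdiff_add_encard_of_subset hsub
  have h5 := encard_sdiff_singleton_add_one (show g ∈ ⋃₀ T from ⟨C, hC, hgC⟩)
  have hlt : N.eRk A + (⋃₀ T \ {g}).encard < N.eRk A + ((⋃₀ T \ {g}).encard + 1) := by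
    have hfin : N.eRk A + (⋃₀ T \ {g}).encard ≠ ⊤ := by
      have h6 : N.eRk A ≠ ⊤ :=
        ne_top_of_le_ne_top (Set.toFinite A).encard_lt_top.ne (N.eRk_le_encard A)
      simp [h6, (Set.toFinite (⋃₀ T \ {g})).encard_lt_top.ne]
    rw [← add_assoc]
    exact ENat.lt_add_one_iff hfin |>.2 le_rfl
  calc N.eRk (⋃₀ T) + A.encard ≤ N.eRk A + ((⋃₀ T \ {g}) \ A).encard + A.encard := by
        rw [h1]; gcongr; exact h2.trans (by gcongr)
    _ = N.eRk A + (⋃₀ T \ {g}).encard := by rw [add_assoc, h4]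
    _ < _ := by rw [← h5]; exact hlt

/-- The height of a union of circuits is at most its nullity. -/
theorem Matroid.height_le_of_encard_le [Finite E] (N : Matroid E)
    (hS : ∀ C ∈ S, N.IsCircuit C) {A B I : Set E} (hA : A ∈ unionLattice S) (hAB : A ⊆ B)
    (hI : N.Indep I) (hIB : I ⊆ B) {m : ℕ} (hm : B.encard ≤ I.encard + m) :
    Order.height (⟨A, hA⟩ : unionLattice S) ≤ m := by
  have hrk : ∀ A : Set E, ((N.eRk A).toNat : ℕ∞) = N.eRk A := fun A =>
    ENat.natCast_toNat (ne_top_of_le_ne_top (Set.toFinite A).encard_lt_top.ne (N.eRk_le_encard A))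
  have hcard : ∀ A : Set E, (A.ncard : ℕ∞) = A.encard := fun A =>
    (Set.toFinite A).cast_ncard_eq
  have hle : ∀ A : Set E, (N.eRk A).toNat ≤ A.ncard := fun A => by
    have := N.eRk_le_encard A
    rw [← hrk, ← hcard] at this
    exact_mod_cast this
  -- The nullity; the subtraction does not truncate, by `hle`. Being strictly monotone with values
  -- in `ℕ`, it bounds the height.
  let ν : unionLattice S → ℕ := fun A => A.1.ncard - (N.eRk A.1).toNat
  have hν : StrictMono ν := by
    intro A B hAB
    have := N.eRk_add_encard_lt_of_ssubset hS B.2 hAB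
    rw [← hrk B.1, ← hrk A.1, ← hcard, ← hcard] at this
    have h' : (N.eRk B.1).toNat + A.1.ncard < (N.eRk A.1).toNat + B.1.ncard := by
      exact_mod_cast this
    have := hle A.1
    have := hle B.1
    simp only [ν]
    omega
  refine (Order.height_le_height_apply_of_strictMono ν hν _).trans ?_
  rw [Order.height_nat]
  norm_cast
  have h1 := N.eRk_le_eRk_add_eRk_sdiff hAB
  have h2 := N.eRk_le_encard (B \ A)
  have h3 := encard_sdiff_add_encard_of_subset hAB
  have h4 := hI.encard_le_eRk_of_subset hIB
  have h5 : I.ncard ≤ (N.eRk B).toNat := by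
    rw [← hcard, ← hrk] at h4; exact_mod_cast h4
  have h6 : (N.eRk B).toNat ≤ (N.eRk A).toNat + (B \ A).ncard := by
    have := h1.trans (add_le_add_right h2 _)
    rw [← hrk A, ← hrk B, ← hcard] at this; exact_mod_cast this
  have h7 : (B \ A).ncard + A.ncard = B.ncard := by
    rw [← hcard, ← hcard, ← hcard] at h3; exact_mod_cast h3
  have h8 : B.ncard ≤ I.ncard + m := by
    rw [← hcard, ← hcard] at hm; exact_mod_cast hm
  simp only [ν]
  omega

end Height

/-! ### Strong elimination under a nullity bound -/

namespace StrongMatroid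

variable {G : Type u} [CommGroup G] {F : Tract G} {E : Type v} [Finite E]

theorem isCircuit_support (M : StrongMatroid F E) {X : E → WithZero G} (hX : X ∈ M.circuits) :
    M.underlying.IsCircuit (Function.support X) := M.underlying_isCircuit_iff.2 ⟨X, hX, rfl⟩

/-- Strong modular elimination, with modularity replaced by a bound on the nullity. -/
theorem elimination_of_encard_le (M : StrongMatroid F E) {k : ℕ} {Xs : Fin k → E → WithZero G}
    {X : E → WithZero G} {e : Fin k → E} {e' : E} (hX : X ∈ M.circuits)
    (hXs : ∀ i, Xs i ∈ M.circuits) (he' : X e' ≠ 0) (he's : ∀ i, Xs i e' = 0)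
    (he : ∀ i j, j ≠ i → Xs j (e i) = 0) (hXe : ∀ i, X (e i) = F.neg (Xs i (e i)))
    (hXe0 : ∀ i, X (e i) ≠ 0) {B I : Set E} (hXB : Function.support X ⊆ B)
    (hXsB : ∀ i, Function.support (Xs i) ⊆ B) (hI : M.underlying.Indep I) (hIB : I ⊆ B)
    (hB : B.encard ≤ I.encard + (k + 1 : ℕ)) :
    ∃ Z ∈ M.circuits, (∀ i, Z (e i) = 0) ∧
      ∀ f, (∑ i, Tract.formal (Xs i f)) + Tract.formal (X f) + Tract.formal (F.neg (Z f))
        ∈ F.nullSet := by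
  have hXse : ∀ i, Xs i (e i) ≠ 0 := fun i => by
    have := hXe0 i
    rwa [hXe i, F.neg_ne_zero_iff] at this
  refine M.modular_elimination k Xs X e hX hXs ⟨?_, ?_, ?_⟩ (fun h => ?_)
    (fun i j hij h => h (he i j hij)) (fun i => ⟨hXe i, hXe0 i⟩)
  · rw [Fin.cons_injective_iff]
    refine ⟨?_, fun i j hij => ?_⟩
    · rintro ⟨i, hi⟩
      have : e' ∈ Function.support (Xs i) := by simp only at hi; rw [hi]; exact he'
      exact this (he's i)
    · by_contra hne
      have : e i ∈ Function.support (Xs j) := by simp only at hij; rw [← hij]; exact hXse i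
      exact this (he i j (Ne.symm hne))
  · refine Fin.cases ⟨X, hX, rfl⟩ fun i => ?_
    exact ⟨Xs i, hXs i, rfl⟩
  · set C : Fin (k + 1) → Set E := Fin.cons (Function.support X)
      (fun i => Function.support (Xs i)) with hCdef
    have hC : ∀ i, C i ∈ Function.support '' M.circuits :=
      Fin.cases ⟨X, hX, rfl⟩ fun i => ⟨Xs i, hXs i, rfl⟩
    have hU := iUnion_mem_unionLattice hC
    refine ⟨hU, le_antisymm ?_ ?_⟩
    · rw [Fintype.card_fin]
      refine M.underlying.height_le_of_encard_le ?_ hU (iUnion_subset ?_) hI hIB hB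
      · rintro _ ⟨Y, hY, rfl⟩
        exact M.isCircuit_support hY
      · exact Fin.cases hXB hXsB
    -- `X` comes first in the family: `e i` does lie in the support of `X`, and only later members
    -- have to avoid it.
    · have := height_add_le_height_union (S := Function.support '' M.circuits)
        empty_mem_unionLattice (k + 1) C (Fin.cons e' e) hC
        (Fin.cases he' hXse) (fun _ h => h)
        (by
          intro i j hij
          induction j using Fin.cases with
          | zero => exact absurd hij (Fin.not_lt_zero _)
          | succ j =>
            induction i using Fin.cases with
            | zero => simpa [hCdef] using he's j
            | succ i =>
              simpa [hCdef] using he i j (by rintro rfl; exact lt_irrefl _ hij))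
        (by rwa [empty_union])
      simp only [empty_union] at this
      rw [Fintype.card_fin]
      exact le_trans (by simp) this
  · obtain ⟨i, hi⟩ := mem_iUnion.1 (h he')
    exact hi (he's i)

end StrongMatroid

/-! ### Tuples, ranges and bases -/

section Tuples

variable {E : Type v} {m : ℕ}

theorem exists_perm_of_range_eq {x y : Fin m → E} (hx : Function.Injective x)
    (h : range y = range x) : ∃ σ : Equiv.Perm (Fin m), y = x ∘ σ := by
  have h1 : ∀ i, ∃ j, x j = y i := fun i => by
    have : y i ∈ range x := h ▸ mem_range_self i
    exact this
  choose σ hσ using h1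
  have hsurj : Function.Surjective σ := by
    intro j
    have : x j ∈ range y := h ▸ mem_range_self j
    obtain ⟨i, hi⟩ := this
    exact ⟨i, hx ((hσ i).trans hi)⟩
  exact ⟨Equiv.ofBijective σ (Finite.injective_iff_bijective.1
    (Finite.injective_iff_surjective.2 hsurj)), funext fun i => (hσ i).symm⟩

theorem exists_tuple_of_ncard_eq [Finite E] {S : Set E} (hS : S.ncard = m) :
    ∃ x : Fin m → E, Function.Injective x ∧ range x = S := by
  let e := (Finite.equivFinOfCardEq (α := S) hS).symm
  exact ⟨fun i => e i, Subtype.val_injective.comp e.injective, by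
    have := e.surjective.range_comp (Subtype.val : S → E)
    simpa [Function.comp_def] using this⟩

theorem cons_comp_succ_succAbove (a : E) (x : Fin (m + 1) → E) (i : Fin (m + 1)) :
    (Fin.cons a x : Fin (m + 2) → E) ∘ i.succ.succAbove = Fin.cons a (x ∘ i.succAbove) := by
  ext j
  refine Fin.cases ?_ (fun j => ?_) j <;> simp

theorem cons_comp_zero_succAbove (a : E) (x : Fin m → E) :
    (Fin.cons a x : Fin (m + 1) → E) ∘ (0 : Fin (m + 1)).succAbove = x := by
  ext j; simp

theorem range_comp_succAbove {x : Fin (m + 1) → E} (hx : Function.Injective x)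
    (k : Fin (m + 1)) : range (x ∘ k.succAbove) = range x \ {x k} := by
  ext e
  constructor
  · rintro ⟨j, rfl⟩
    exact ⟨⟨_, rfl⟩, fun h => Fin.succAbove_ne k j (hx h)⟩
  · rintro ⟨⟨j, rfl⟩, hj⟩
    obtain ⟨i, rfl⟩ := Fin.exists_succAbove_eq (show j ≠ k by rintro rfl; exact hj rfl)
    exact ⟨i, rfl⟩

end Tuples

theorem Tract.IsAntisymm.comp_perm_ne_zero_iff {G : Type u} [CommGroup G] {F : Tract G}
    {E : Type v} {m : ℕ} {f : (Fin m → E) → WithZero G} (hf : F.IsAntisymm f)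
    (σ : Equiv.Perm (Fin m)) : ∀ x, f (x ∘ σ) ≠ 0 ↔ f x ≠ 0 := by
  induction σ using Equiv.Perm.swap_induction_on with
  | one => intro x; rfl
  | swap_mul σ i j hij ih =>
    intro x
    have := ih (x ∘ Equiv.swap i j)
    rw [hf x i j hij, F.neg_ne_zero_iff] at this
    exact this

section Rank

variable {E : Type v} [Finite E] {N : Matroid E} {B B' S : Set E}

theorem Matroid.IsBase.of_closure_eq (hB : N.IsBase B) (hS : S.ncard ≤ B.ncard)
    (h : N.closure S = N.E) (hSE : S ⊆ N.E := by aesop_mat) : N.IsBase S := by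
  obtain ⟨B', hB', hB'S⟩ := ((Matroid.spanning_iff_closure_eq hSE).2 h).exists_isBase_subset
  have : B' = S := eq_of_subset_of_ncard_le hB'S
    (by rw [hB'.ncard_eq_ncard_of_isBase hB]; exact hS) (toFinite S)
  rwa [← this]

/-- Removing a point of a circuit from a spanning set of size `r + 1` gives a base. -/
theorem Matroid.IsBase.sdiff_isBase_iff (hB : N.IsBase B) {C : Set E} (hC : N.IsCircuit C)
    (hCS : C ⊆ S) (hBS : B ⊆ S) (hS : S.ncard = B.ncard + 1) {e : E} (he : e ∈ S)
    (hSE : S ⊆ N.E := by aesop_mat) :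
    N.IsBase (S \ {e}) ↔ e ∈ C := by
  constructor
  · intro h
    by_contra heC
    exact hC.not_indep (h.indep.subset fun a ha => ⟨hCS ha, by rintro rfl; exact heC ha⟩)
  · intro heC
    refine hB.of_closure_eq ?_ ?_ (sdiff_subset.trans hSE)
    · rw [ncard_sdiff_singleton_of_mem he, hS]; simp
    · rw [Matroid.closure_sdiff_singleton_eq_closure]
      · exact hB.closure_of_superset hBS
      · exact N.closure_subset_closure (sdiff_subset_sdiff_left hCS)
          (hC.mem_closure_sdiff_singleton_of_mem heC)

end Rank

/-! ### Vectors orthogonal to a Grassmann–Plücker function -/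

namespace GPFunction

variable {G : Type u} [CommGroup G] {F : Tract G} {E : Type v} {n : ℕ}

theorem isAntisymm (φ : GPFunction F E n) : F.IsAntisymm φ.toFun := φ.map_swap

theorem ne_zero_iff [Finite E] (φ : GPFunction F E n) (x : Fin (n + 1) → E) :
    φ.toFun x ≠ 0 ↔ φ.underlying.IsBase (range x) := by
  rw [underlying_isBase_iff]
  refine ⟨fun h => ⟨x, h, rfl⟩, ?_⟩
  rintro ⟨y, hy, hyx⟩
  obtain ⟨σ, rfl⟩ := exists_perm_of_range_eq (φ.injective_of_ne_zero hy) hyx.symm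
  exact (φ.isAntisymm.comp_perm_ne_zero_iff σ y).2 hy

theorem ncard_of_isBase [Finite E] (φ : GPFunction F E n) {B : Set E}
    (hB : φ.underlying.IsBase B) : B.ncard = n + 1 := by
  obtain ⟨x, hx, rfl⟩ := φ.underlying_isBase_iff.1 hB
  rw [← image_univ, ncard_image_of_injective _ (φ.injective_of_ne_zero hx), ncard_univ,
    Nat.card_fin]

theorem subset_ground [Finite E] (φ : GPFunction F E n) (S : Set E) : S ⊆ φ.underlying.E :=
  subset_univ S

theorem toFun_cons_eq_zero (φ : GPFunction F E n) {e : E} {y : Fin n → E} (he : e ∈ range y) :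
    φ.toFun (Fin.cons e y) = 0 := by
  obtain ⟨j, rfl⟩ := he
  exact φ.map_eq_zero _ 0 j.succ (Fin.succ_ne_zero j).symm (by simp)

variable (φ : GPFunction F E n)

/-- The vector supported in `{x₁, …, x_{r+1}}` with coordinates `± φ(x₁, …, x̂_k, …, x_{r+1})`. -/
noncomputable def circuitVector (w : Fin (n + 2) → E) : E → WithZero G :=
  Function.extend w (fun k => F.sign k * φ.toFun (w ∘ k.succAbove)) 0

theorem circuitVector_apply {w : Fin (n + 2) → E} (hw : Function.Injective w) (k : Fin (n + 2)) :
    φ.circuitVector w (w k) = F.sign k * φ.toFun (w ∘ k.succAbove) := hw.extend_apply _ _ k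

theorem circuitVector_eq_zero {w : Fin (n + 2) → E} {e : E} (he : e ∉ range w) :
    φ.circuitVector w e = 0 := Function.extend_apply' _ _ _ he

variable [Fintype E]

/-- Orthogonality of a vector to all the vectors `φ(·, y₁, …, y_{r-1})`. -/
def IsOrthogonal (X : E → WithZero G) : Prop :=
  ∀ y : Fin n → E, ∑ e, Tract.formal (X e * φ.toFun (Fin.cons e y)) ∈ F.nullSet

/-- The vectors supported on circuits of `M_φ` and orthogonal to all `φ(·, y₁, …, y_{r-1})`. -/
def circuitSet : Set (E → WithZero G) :=
  {X | φ.underlying.IsCircuit (Function.support X) ∧ φ.IsOrthogonal X}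

variable {φ}

theorem IsOrthogonal.smul {X : E → WithZero G} (hX : φ.IsOrthogonal X) (α : WithZero G) :
    φ.IsOrthogonal fun e => α * X e := by
  intro y
  have := F.formal_mul_mem α (hX y)
  simpa only [Finset.mul_sum, ← map_mul, ← mul_assoc] using this

/-- Only the terms at `a` and `b` survive in the orthogonality sum. Every ratio formula for circuits
of `φ` comes from this. -/
theorem IsOrthogonal.eq_neg {X : E → WithZero G} (hX : φ.IsOrthogonal X) {y : Fin n → E}
    {a b : E} (hab : a ≠ b) (h : ∀ e, e ≠ a → e ≠ b → X e ≠ 0 → φ.toFun (Fin.cons e y) = 0) :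
    X a * φ.toFun (Fin.cons a y) = F.neg (X b * φ.toFun (Fin.cons b y)) := by
  rw [← F.formal_add_formal_mem_iff]
  have := hX y
  rwa [Fintype.sum_eq_add a b hab] at this
  rintro e ⟨hea, heb⟩
  by_cases hXe : X e = 0
  · simp [hXe]
  · simp [h e hea heb hXe]

theorem notMem_range_of_isCircuit {C : Set E} (hC : φ.underlying.IsCircuit C) {x₀ : E}
    {x : Fin (n + 1) → E} (hx : φ.toFun x ≠ 0) (hCx : C \ {x₀} ⊆ range x) : x₀ ∉ range x := by
  intro h
  refine hC.not_indep (((φ.ne_zero_iff x).1 hx).indep.subset fun e he => ?_)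
  by_cases hex : e = x₀
  · rwa [hex]
  · exact hCx ⟨he, hex⟩

/-- The formula for the coordinates of the circuits of `φ`. -/
theorem div_eq_of_mem_circuitSet {X : E → WithZero G} (hX : X ∈ φ.circuitSet) {x₀ : E}
    {x : Fin (n + 1) → E} (hx₀ : x₀ ∈ Function.support X) (hx : φ.toFun x ≠ 0)
    (hXx : Function.support X \ {x₀} ⊆ range x) (i : Fin (n + 1)) :
    X (x i) / X x₀ = F.sign ((i : ℕ) + 1) *
      (φ.toFun ((Fin.cons x₀ x : Fin (n + 2) → E) ∘ i.succ.succAbove) / φ.toFun x) := by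
  have hx₀x := notMem_range_of_isCircuit hX.1 hx hXx
  have hxi : x₀ ≠ x i := fun h => hx₀x ⟨i, h.symm⟩
  -- With the `i`-th entry omitted, every element of the support other than `x₀` and `x i` repeats
  -- an entry of `y`.
  have h := hX.2.eq_neg (y := x ∘ i.succAbove) hxi (by
    intro e he0 hei hXe
    apply φ.toFun_cons_eq_zero
    rw [range_comp_succAbove (φ.injective_of_ne_zero hx)]
    exact ⟨hXx ⟨hXe, he0⟩, hei⟩)
  rw [φ.isAntisymm.cons_succAbove, Tract.eq_neg_comm] at h
  rw [cons_comp_succ_succAbove, div_eq_iff hx₀, Tract.sign_succ]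
  have h2 : X (x i) = F.sign i * F.sign i * (X (x i) * φ.toFun x) / φ.toFun x := by
    rw [F.sign_mul_sign, one_mul, mul_div_cancel_right₀ _ hx]
  have h3 : F.sign i * F.sign i * (X (x i) * φ.toFun x) =
    F.sign i * (X (x i) * (F.sign i * φ.toFun x)) := by
      simp only [mul_assoc, mul_left_comm]
  rw [h2, h3, h, Tract.neg]
  simp only [div_eq_mul_inv]
  ac_rfl

variable (φ)

theorem isOrthogonal_circuitVector {w : Fin (n + 2) → E} (hw : Function.Injective w) :
    φ.IsOrthogonal (φ.circuitVector w) := by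
  intro y
  by_cases hy : Function.Injective y
  -- GP3 carries the sign of `k + 1` and the circuit vector that of `k`; the factor `ε` makes up the
  -- difference.
  · have := F.formal_mul_mem F.eps (φ.relation w y hw hy)
    rw [Finset.mul_sum] at this
    rw [← Fintype.sum_of_injective w hw (fun k => Tract.formal (F.eps : WithZero G) *
      Tract.formal (F.sign ((k : ℕ) + 1) *
        (φ.toFun (w ∘ k.succAbove) * φ.toFun (Fin.cons (w k) y))))]
    · exact this
    · intro e he
      simp [φ.circuitVector_eq_zero he]
    · intro k
      rw [φ.circuitVector_apply hw, ← map_mul, F.sign_succ, mul_assoc, F.eps_mul_eps_mul,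
        mul_assoc]
  · have : ∀ e, φ.toFun (Fin.cons e y) = 0 := by
      intro e
      by_contra h
      exact hy (Fin.cons_injective_iff.1 (φ.injective_of_ne_zero h)).2
    simpa [this] using F.zero_mem

variable {φ}

/-- The formula says that `X` is a scalar multiple of the circuit vector of `(x₀, x)`, whose
orthogonality is GP3. -/
theorem mem_circuitSet_of_div_eq {X : E → WithZero G} {x₀ : E}
    {x : Fin (n + 1) → E} (hX : φ.underlying.IsCircuit (Function.support X))
    (hx₀ : x₀ ∈ Function.support X) (hx : φ.toFun x ≠ 0)
    (hXx : Function.support X \ {x₀} ⊆ range x)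
    (h : ∀ i : Fin (n + 1), X (x i) / X x₀ = F.sign ((i : ℕ) + 1) *
      (φ.toFun ((Fin.cons x₀ x : Fin (n + 2) → E) ∘ i.succ.succAbove) / φ.toFun x)) :
    X ∈ φ.circuitSet := by
  refine ⟨hX, ?_⟩
  have hx₀x := notMem_range_of_isCircuit hX hx hXx
  have hw : Function.Injective (Fin.cons x₀ x : Fin (n + 2) → E) :=
    Fin.cons_injective_iff.2 ⟨hx₀x, φ.injective_of_ne_zero hx⟩
  have : X = fun e => X x₀ / φ.toFun x * φ.circuitVector (Fin.cons x₀ x) e := by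
    funext e
    by_cases he : e ∈ range (Fin.cons x₀ x : Fin (n + 2) → E)
    · obtain ⟨k, rfl⟩ := he
      rw [φ.circuitVector_apply hw]
      induction k using Fin.cases with
      | zero =>
        rw [cons_comp_zero_succAbove]
        simp [Tract.sign, hx]
      | succ i =>
        have := h i
        rw [div_eq_iff hx₀] at this
        rw [Fin.cons_succ, this, Fin.val_succ]
        simp only [div_eq_mul_inv]
        ac_rfl
    · rw [φ.circuitVector_eq_zero he, mul_zero]
      by_contra hXe
      apply he
      by_cases hex : e = x₀
      · exact ⟨0, by simp [hex]⟩
      · obtain ⟨i, hi⟩ := hXx ⟨hXe, hex⟩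
        exact ⟨i.succ, by simpa using hi⟩
  rw [this]
  exact (φ.isOrthogonal_circuitVector hw).smul _

variable (φ)

theorem exists_tuple_of_isCircuit {C : Set E} (hC : φ.underlying.IsCircuit C) {x₀ : E}
    (hx₀ : x₀ ∈ C) : ∃ x : Fin (n + 1) → E, φ.toFun x ≠ 0 ∧ C \ {x₀} ⊆ range x := by
  obtain ⟨B, hB, hCB⟩ := (hC.sdiff_singleton_indep hx₀).exists_isBase_superset
  obtain ⟨x, hx, rfl⟩ := φ.underlying_isBase_iff.1 hB
  exact ⟨x, hx, hCB⟩

/-- The circuit vector of `(x₀, x)` works, for a base `x` containing `C \ {x₀}`: its coordinate at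
`e` is nonzero exactly when removing `e` from this spanning set leaves a base, that is, when `e ∈
C`. -/
theorem exists_mem_circuitSet {C : Set E} (hC : φ.underlying.IsCircuit C) :
    ∃ X ∈ φ.circuitSet, Function.support X = C := by
  obtain ⟨x₀, hx₀⟩ := hC.nonempty
  obtain ⟨x, hx, hCx⟩ := φ.exists_tuple_of_isCircuit hC hx₀
  have hx₀x := notMem_range_of_isCircuit hC hx hCx
  set w : Fin (n + 2) → E := Fin.cons x₀ x with hw'
  have hw : Function.Injective w := Fin.cons_injective_iff.2 ⟨hx₀x, φ.injective_of_ne_zero hx⟩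
  have hrange : range w = insert x₀ (range x) := Fin.range_cons _ _
  have hCw : C ⊆ range w := by
    intro e he
    rw [hrange]
    by_cases hex : e = x₀
    · exact Or.inl hex
    · exact Or.inr (hCx ⟨he, hex⟩)
  have hB := (φ.ne_zero_iff x).1 hx
  have hsupp : Function.support (φ.circuitVector w) = C := by
    ext e
    by_cases he : e ∈ range w
    · have hmem : φ.underlying.IsBase (range w \ {e}) ↔ e ∈ C :=
        hB.sdiff_isBase_iff hC hCw (hrange ▸ subset_insert _ _)
          (by rw [hrange, ncard_insert_of_notMem hx₀x]) he (φ.subset_ground _)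
      obtain ⟨k, rfl⟩ := he
      rw [← hmem, ← range_comp_succAbove hw, ← φ.ne_zero_iff, Function.mem_support,
        φ.circuitVector_apply hw, mul_ne_zero_iff]
      exact and_iff_right (F.sign_ne_zero _)
    · simp only [Function.mem_support, φ.circuitVector_eq_zero he, ne_eq, not_true, false_iff]
      exact fun h => he (hCw h)
  exact ⟨_, ⟨by rwa [hsupp], φ.isOrthogonal_circuitVector hw⟩, hsupp⟩

variable {φ}

theorem smul_mem_circuitSet {X : E → WithZero G} (hX : X ∈ φ.circuitSet) (α : G) :
    (fun e => (α : WithZero G) * X e) ∈ φ.circuitSet :=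
  ⟨by rw [Tract.support_coe_mul]; exact hX.1, hX.2.smul _⟩

/-- The coordinate formula determines both vectors from their values at a common `x₀`, so the scalar
is `X x₀ / Y x₀`. -/
theorem eq_smul_of_mem_circuitSet {X Y : E → WithZero G} (hX : X ∈ φ.circuitSet)
    (hY : Y ∈ φ.circuitSet) (hXY : Function.support X ⊆ Function.support Y) :
    ∃ α : G, X = fun e => (α : WithZero G) * Y e := by
  have hsupp := hX.1.eq_of_subset_isCircuit hY.1 hXY
  obtain ⟨x₀, hx₀⟩ := hX.1.nonempty
  have hy₀ : x₀ ∈ Function.support Y := hsupp ▸ hx₀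
  obtain ⟨x, hx, hCx⟩ := φ.exists_tuple_of_isCircuit hX.1 hx₀
  have hX' := div_eq_of_mem_circuitSet hX hx₀ hx hCx
  have hY' := div_eq_of_mem_circuitSet hY hy₀ hx (hsupp ▸ hCx)
  obtain ⟨α, hα⟩ := WithZero.ne_zero_iff_exists.1 (div_ne_zero hx₀ hy₀)
  refine ⟨α, funext fun e => ?_⟩
  rw [hα]
  by_cases he : e ∈ Function.support X
  · by_cases hex : e = x₀
    · rw [hex, div_mul_cancel₀ _ hy₀]
    · obtain ⟨i, rfl⟩ := hCx ⟨he, hex⟩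
      have := (hX' i).trans (hY' i).symm
      rw [div_eq_iff hx₀] at this
      rw [this]
      simp only [div_eq_mul_inv]
      ac_rfl
  · have he' : e ∉ Function.support Y := hsupp ▸ he
    rw [Function.notMem_support] at he he'
    rw [he, he', mul_zero]

end GPFunction

/-! ### The strong matroid of a Grassmann–Plücker function -/

namespace GPFunction

variable {G : Type u} [CommGroup G] {F : Tract G} {E : Type v} {n : ℕ} [Fintype E]
  {φ : GPFunction F E n}

theorem image_support_circuitSet :
    Function.support '' φ.circuitSet = {C | φ.underlying.IsCircuit C} := by
  ext C
  constructor
  · rintro ⟨X, hX, rfl⟩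
    exact hX.1
  · intro hC
    obtain ⟨X, hX, hXC⟩ := φ.exists_mem_circuitSet hC
    exact ⟨X, hX, hXC⟩

/-- Removing a private point of each member of a modular family from the union leaves an
independent set. -/
theorem indep_of_isModularFamily {k : ℕ} {C : Fin (k + 1) → Set E}
    (hC : IsModularFamily {C | φ.underlying.IsCircuit C} C) {p : Fin (k + 1) → E}
    (hp : ∀ i, p i ∈ C i) (hpC : ∀ i j, i < j → p i ∉ C j) :
    φ.underlying.Indep ((⋃ i, C i) \ range p) := by
  by_contra hcon
  obtain ⟨D, hDs, hD⟩ := ((Matroid.not_indep_iff (φ.subset_ground _)).1 hcon).exists_isCircuit_subset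
  obtain ⟨-, hCmem, hU, hheight⟩ := hC
  have hDU : D ∪ ⋃ i, C i = ⋃ i, C i := union_eq_right.2 (hDs.trans sdiff_subset)
  have hDm := mem_unionLattice_of_mem (S := {C | φ.underlying.IsCircuit C}) hD
  -- The circuit `D` avoids all private points, so the `k + 1` sets add at least `k + 1` to its
  -- height, which is already at least `1`.
  have h1 := height_add_le_height_union hDm (k + 1) C p hCmem hp
    (fun i hi => (hDs hi).2 ⟨i, rfl⟩) hpC (by rwa [hDU])
  simp only [hDU] at h1
  rw [hheight, Fintype.card_fin] at h1
  have h0 : (⟨∅, empty_mem_unionLattice⟩ : unionLattice {C | φ.underlying.IsCircuit C}) <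
      ⟨D, hDm⟩ := by
    rw [Subtype.mk_lt_mk]
    exact empty_ssubset.2 hD.nonempty
  have h2 := Order.height_add_one_le h0
  have h3 : (1 : ℕ∞) ≤ Order.height
      (⟨D, hDm⟩ : unionLattice {C | φ.underlying.IsCircuit C}) := le_trans (by simp) h2
  have h4 : (1 : ℕ∞) + (k + 1 : ℕ) ≤ (k + 1 : ℕ) := le_trans (by gcongr) h1
  have h5 : 1 + (k + 1) ≤ k + 1 := by exact_mod_cast h4
  omega

/-- Supplies the test tuple that isolates a coordinate: `φ(·, y)` vanishes on `B \ {f}` but not at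
`f`. -/
theorem exists_tuple_range_eq_sdiff {B : Set E} (hB : φ.underlying.IsBase B) {f : E}
    (hf : f ∈ B) : ∃ y : Fin n → E, range y = B \ {f} ∧ φ.toFun (Fin.cons f y) ≠ 0 := by
  obtain ⟨y, -, hy⟩ := exists_tuple_of_ncard_eq (S := B \ {f}) (m := n) (by
    rw [ncard_sdiff_singleton_of_mem hf, φ.ncard_of_isBase hB]; simp)
  refine ⟨y, hy, ?_⟩
  rw [φ.ne_zero_iff, Fin.range_cons, hy, insert_sdiff_singleton, insert_eq_of_mem hf]
  exact hB

/-- `Z` is built from the independent set `B` left after deleting `e'` and the `e i` from the union.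
The relation is immediate at `e'`, at the `e i` and outside the union; on `B` it is the
orthogonality of `X` in disguise. -/
theorem modular_elimination_circuitSet {k : ℕ} {Xs : Fin k → E → WithZero G}
    {X : E → WithZero G} {e : Fin k → E} (hX : X ∈ φ.circuitSet)
    (hXs : ∀ i, Xs i ∈ φ.circuitSet)
    (hmod : IsModularFamily {C | φ.underlying.IsCircuit C}
      (Fin.cons (Function.support X) (fun i => Function.support (Xs i)) : Fin (k + 1) → Set E))
    (hsub : ¬ (Function.support X ⊆ ⋃ i, Function.support (Xs i)))
    (he : ∀ i, ∀ j, j ≠ i → Xs j (e i) = 0)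
    (hXe : ∀ i, X (e i) = F.neg (Xs i (e i))) (hXe0 : ∀ i, X (e i) ≠ 0) :
    ∃ Z ∈ φ.circuitSet, (∀ i, Z (e i) = 0) ∧
      ∀ f, (∑ i, Tract.formal (Xs i f)) + Tract.formal (X f) + Tract.formal (F.neg (Z f))
        ∈ F.nullSet := by
  obtain ⟨e', he', he's⟩ := not_subset.1 hsub
  have he's : ∀ i, Xs i e' = 0 := fun i => by
    by_contra h
    exact he's (mem_iUnion.2 ⟨i, h⟩)
  have hXse : ∀ i, Xs i (e i) ≠ 0 := fun i => by
    have := hXe0 i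
    rwa [hXe i, F.neg_ne_zero_iff] at this
  have hee' : ∀ i, e i ≠ e' := fun i h => hXse i (by rw [h]; exact he's i)
  have heinj : Function.Injective e := by
    intro i j hij
    by_contra hne
    exact hXse i (by rw [hij]; exact he j i hne)
  set C : Fin (k + 1) → Set E := Fin.cons (Function.support X)
      (fun i => Function.support (Xs i)) with hCdef
  set A : Set E := ⋃ i, C i with hA
  have hXA : ∀ f, X f ≠ 0 → f ∈ A := fun f hf => mem_iUnion.2 ⟨0, hf⟩
  have hXsA : ∀ i f, Xs i f ≠ 0 → f ∈ A := fun i f hf => mem_iUnion.2 ⟨i.succ, hf⟩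
  set p : Fin (k + 1) → E := Fin.cons e' e with hp
  set B := A \ range p with hBdef
  have hB : φ.underlying.Indep B := by
    refine indep_of_isModularFamily hmod (Fin.cases he' hXse) ?_
    intro i j hij
    induction j using Fin.cases with
    | zero => exact absurd hij (Fin.not_lt_zero _)
    | succ j =>
      induction i using Fin.cases with
      | zero => exact fun h => h (he's j)
      | succ i => exact fun h => h (he i j (by rintro rfl; exact lt_irrefl _ hij))
  have hmemB : ∀ f, f ∈ A → f ≠ e' → (∀ i, f ≠ e i) → f ∈ B := by
    rintro f hf h1 h2
    refine ⟨hf, ?_⟩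
    rw [hp, Fin.range_cons]
    rintro (h | ⟨i, hi⟩)
    · exact h1 h
    · exact h2 i hi.symm
  have hB1 : ∀ f ∈ B, f ≠ e' := by
    rintro f hf rfl
    exact hf.2 ⟨0, by simp [hp]⟩
  have hB2 : ∀ f ∈ B, ∀ i, f ≠ e i := by
    rintro f hf i rfl
    exact hf.2 ⟨i.succ, by simp [hp]⟩
  -- the circuit through `e'`
  have hecl : ∀ i, e i ∈ φ.underlying.closure B := by
    intro i
    refine φ.underlying.closure_subset_closure ?_
      ((hXs i).1.mem_closure_sdiff_singleton_of_mem (hXse i))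
    rintro f ⟨hf, hfe⟩
    refine hmemB f (hXsA i f hf) ?_ ?_
    · rintro rfl; exact hf (he's i)
    · rintro j rfl
      exact hf (he j i (by rintro rfl; exact hfe rfl))
  have hBcl : B ⊆ φ.underlying.closure B := φ.underlying.subset_closure B (φ.subset_ground _)
  -- Apart from `e'`, the support of `X` lies in `B` together with the `e i`, which are already in
  -- the closure of `B`.
  have he'cl : e' ∈ φ.underlying.closure B := by
    have h1 : Function.support X \ {e'} ⊆ φ.underlying.closure B := by
      rintro f ⟨hf, hfe⟩
      by_cases h : ∃ i, f = e i
      · obtain ⟨i, rfl⟩ := h; exact hecl i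
      · push Not at h
        exact hBcl (hmemB f (hXA f hf) hfe h)
    have := φ.underlying.closure_subset_closure h1 (hX.1.mem_closure_sdiff_singleton_of_mem he')
    rwa [Matroid.closure_closure] at this
  have he'B : e' ∉ B := fun h => hB1 _ h rfl
  obtain ⟨Z₀, hZ₀, hZ₀s⟩ := φ.exists_mem_circuitSet (hB.fundCircuit_isCircuit he'cl he'B)
  have hZ₀e' : Z₀ e' ≠ 0 := by
    change e' ∈ Function.support Z₀
    rw [hZ₀s]; exact φ.underlying.mem_fundCircuit _ _
  have hZ₀B : ∀ f, Z₀ f ≠ 0 → f = e' ∨ f ∈ B := by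
    intro f hf
    have : f ∈ Function.support Z₀ := hf
    rw [hZ₀s] at this
    exact φ.underlying.fundCircuit_subset_insert _ _ this
  -- The scaling makes `Z` agree with `X` at `e'`, where no `Xs i` contributes.
  obtain ⟨α, hα⟩ := WithZero.ne_zero_iff_exists.1 (div_ne_zero he' hZ₀e')
  set Z : E → WithZero G := fun f => (α : WithZero G) * Z₀ f with hZdef
  have hZ : Z ∈ φ.circuitSet := smul_mem_circuitSet hZ₀ α
  have hZe' : Z e' = X e' := by
    simp only [hZdef]; rw [hα, div_mul_cancel₀ _ hZ₀e']
  have hZB : ∀ f, f ≠ e' → f ∉ B → Z f = 0 := by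
    intro f h1 h2
    by_contra h
    exact (hZ₀B f (right_ne_zero_of_mul h)).elim h1 h2
  refine ⟨Z, hZ, fun i => hZB _ (hee' i) fun h => hB2 _ h i rfl, fun f => ?_⟩
  by_cases hfe' : f = e'
  · subst hfe'
    rw [hZe']
    simp only [he's, map_zero, Finset.sum_const_zero, zero_add]
    rw [F.formal_add_formal_mem_iff, F.neg_neg]
  by_cases hfe : ∃ i, f = e i
  · obtain ⟨i, rfl⟩ := hfe
    rw [hZB _ hfe' fun h => hB2 _ h i rfl, Finset.sum_eq_single i
      (fun j _ hj => by rw [he i j hj, map_zero]) (fun h => absurd (Finset.mem_univ i) h)]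
    rw [show F.neg (0 : WithZero G) = 0 from mul_zero _, map_zero, add_zero,
      F.formal_add_formal_mem_iff, Tract.eq_neg_comm]
    exact hXe i
  push Not at hfe
  by_cases hfB : f ∈ B
  -- For `y` enumerating `B' \ {f}`, the circuit `Xs i` relates only `f` and `e i`, and `Z` only `f`
  -- and `e'`. Multiplied by `Y f`, the desired sum becomes the orthogonality sum of `X` over `f`,
  -- `e'` and the `e i`.
  · obtain ⟨B', hB', hBB'⟩ := hB.exists_isBase_superset
    obtain ⟨y, hy, hfy⟩ := exists_tuple_range_eq_sdiff hB' (hBB' hfB)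
    have hzero : ∀ g ∈ B, g ≠ f → φ.toFun (Fin.cons g y) = 0 := by
      intro g hg hgf
      apply φ.toFun_cons_eq_zero
      rw [hy]; exact ⟨hBB' hg, hgf⟩
    set Y : E → WithZero G := fun g => φ.toFun (Fin.cons g y) with hY
    have hXs' : ∀ i, Xs i f * Y f = X (e i) * Y (e i) := by
      intro i
      have := (hXs i).2.eq_neg (y := y) (hfe i) (by
        intro g hgf hge hg
        refine hzero g (hmemB g (hXsA i g hg) ?_ ?_) hgf
        · rintro rfl; exact hg (he's i)
        · rintro j rfl
          exact hg (he j i (by rintro rfl; exact hge rfl)))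
      rw [hY]
      simp only
      rw [this, hXe i, Tract.neg, Tract.neg, mul_assoc]
    have hZ' : F.neg (Z f) * Y f = X e' * Y e' := by
      have := hZ.2.eq_neg (y := y) hfe' (by
        intro g hgf hge hg
        refine hzero g ?_ hgf
        by_contra hgB
        exact hg (hZB g hge hgB))
      rw [Tract.neg, mul_assoc]
      simp only [hY]
      rw [this, Tract.neg, F.eps_mul_eps_mul, hZe']
    have hq : Function.Injective (Fin.cons f p : Fin (k + 2) → E) := by
      rw [Fin.cons_injective_iff]
      refine ⟨hfB.2, ?_⟩
      rw [hp, Fin.cons_injective_iff]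
      exact ⟨by rintro ⟨i, hi⟩; exact hee' i hi, heinj⟩
    have hX' := hX.2 y
    rw [← Fintype.sum_of_injective _ hq (fun i => Tract.formal
        (X ((Fin.cons f p : Fin (k + 2) → E) i) * Y ((Fin.cons f p : Fin (k + 2) → E) i)))
        _ ?_ (fun i => rfl)] at hX'
    · rw [Fin.sum_univ_succ, Fin.sum_univ_succ] at hX'
      simp only [Fin.cons_zero, Fin.cons_succ, hp] at hX'
      rw [← F.formal_mul_mem_iff (α := Y f) hfy, mul_add, mul_add, Finset.mul_sum]
      simp only [← map_mul, mul_comm (Y f)]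
      rw [hZ', Finset.sum_congr rfl fun i _ => by rw [hXs' i]]
      convert hX' using 1
      abel
    · intro g hg
      rw [Fin.range_cons, hp, Fin.range_cons] at hg
      simp only [mem_insert_iff, mem_range, not_or, not_exists] at hg
      by_cases hXg : X g = 0
      · simp [hXg]
      · rw [hzero g (hmemB g (hXA g hXg) hg.2.1 fun i h => hg.2.2 i h.symm) hg.1, mul_zero,
          map_zero]
  · have hfA : f ∉ A := fun h => hfB (hmemB f h hfe' hfe)
    have h1 : X f = 0 := by by_contra h; exact hfA (hXA f h)
    have h2 : ∀ i, Xs i f = 0 := fun i => by by_contra h; exact hfA (hXsA i f h)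
    rw [hZB f hfe' hfB, h1]
    simp only [h2, Tract.neg, mul_zero, map_zero, Finset.sum_const_zero, add_zero]
    exact F.zero_mem

variable (φ)

/-- The strong matroid of a Grassmann–Plücker function. -/
def toStrongMatroid : StrongMatroid F E where
  circuits := φ.circuitSet
  zero_notMem h := h.1.nonempty.ne_empty (Function.support_zero)
  smul_mem _ hX α := smul_mem_circuitSet hX α
  incomparable _ hX _ hY h := eq_smul_of_mem_circuitSet hX hY h
  modular_elimination _ _ _ _ hX hXs hmod hsub he hXe :=
    modular_elimination_circuitSet hX hXs (image_support_circuitSet (φ := φ) ▸ hmod) hsub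
      (fun i j hij => Function.notMem_support.1 (he i j hij)) (fun i => (hXe i).1)
      (fun i => (hXe i).2)

theorem underlying_toStrongMatroid : φ.toStrongMatroid.underlying = φ.underlying := by
  refine Matroid.ext_isCircuit rfl fun C _ => ?_
  rw [StrongMatroid.underlying_isCircuit_iff]
  constructor
  · rintro ⟨X, hX, rfl⟩
    exact hX.1
  · exact φ.exists_mem_circuitSet

theorem rank_toStrongMatroid : φ.toStrongMatroid.rank = ((n + 1 : ℕ) : ℕ∞) := by
  obtain ⟨B, hB⟩ := φ.underlying.exists_isBase
  rw [StrongMatroid.rank, underlying_toStrongMatroid, ← hB.encard_eq_eRank,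
    ← φ.ncard_of_isBase hB, (toFinite B).cast_ncard_eq]

end GPFunction

/-! ### Compatible functions on contractions and their uniqueness -/

theorem union_range_cons {E : Type v} {m : ℕ} (K : Set E) (e : E) (x : Fin m → E) :
    K ∪ range (Fin.cons e x : Fin (m + 1) → E) = insert e K ∪ range x := by
  rw [Fin.range_cons, union_insert, insert_union]

theorem ncard_union_range_le {E : Type v} {m : ℕ} (K : Set E) (x : Fin m → E) :
    (K ∪ range x).ncard ≤ K.ncard + m := by
  refine (ncard_union_le _ _).trans ?_
  gcongr
  rw [← image_univ]
  refine (ncard_image_le).trans ?_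
  simp [ncard_univ]

theorem Tract.IsAntisymm.cons_cons {G : Type u} [CommGroup G] {F : Tract G} {E : Type v} {m : ℕ}
    {f : (Fin (m + 2) → E) → WithZero G} (hf : F.IsAntisymm f) (e e' : E) (x : Fin m → E) :
    f (Fin.cons e (Fin.cons e' x)) = F.neg (f (Fin.cons e' (Fin.cons e x))) := by
  rw [← hf _ 0 1 (by simp)]
  congr 1
  ext k
  refine Fin.cases ?_ (fun k => ?_) k
  · simp
  · refine Fin.cases ?_ (fun k => ?_) k
    · simp
    · simp [Equiv.swap_apply_def, Fin.ext_iff]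

namespace StrongMatroid

variable {G : Type u} [CommGroup G] {F : Tract G} {E : Type v} [Finite E]
  (M : StrongMatroid F E)

theorem subset_ground (S : Set E) : S ⊆ M.underlying.E := subset_univ S

/-- `φ` is a Grassmann–Plücker function for the contraction of `M` by the independent set `K`, as
far as the signs, the support, and the ratios of values on adjacent bases are concerned. -/
structure IsCompatible (K : Set E) {m : ℕ} (φ : (Fin m → E) → WithZero G) : Prop where
  antisymm : F.IsAntisymm φ
  ne_zero_iff : ∀ x, φ x ≠ 0 ↔ M.underlying.IsBase (K ∪ range x)
  ratio : ∀ X ∈ M.circuits, ∀ x x' : Fin m → E, ∀ i, (∀ j, j ≠ i → x j = x' j) → x i ≠ x' i →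
    φ x ≠ 0 → φ x' ≠ 0 → Function.support X ⊆ K ∪ range x ∪ range x' →
    X (x i) * φ x = F.neg (X (x' i) * φ x')

variable {M} {K : Set E} {m : ℕ}

/-- Fixing the first argument corresponds to contracting one more element; this drives the
inductions on the corank. -/
theorem IsCompatible.cons {φ : (Fin (m + 1) → E) → WithZero G} (h : M.IsCompatible K φ) (e : E) :
    M.IsCompatible (insert e K) fun x : Fin m → E => φ (Fin.cons e x) where
  antisymm x i j hij := by
    rw [← h.antisymm _ i.succ j.succ (fun hh => hij (Fin.succ_injective _ hh))]
    change φ _ = φ _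
    congr 1
    ext k
    refine Fin.cases ?_ (fun k => ?_) k
    · rw [Function.comp_apply, Equiv.swap_apply_of_ne_of_ne (Fin.succ_ne_zero i).symm
        (Fin.succ_ne_zero j).symm, Fin.cons_zero, Fin.cons_zero]
    · simp only [Function.comp, Fin.cons_succ]
      rw [← (Fin.succ_injective m).map_swap, Fin.cons_succ]
  ne_zero_iff x := by rw [h.ne_zero_iff, union_range_cons]
  ratio X hX x x' i hxx' hi hx hx' hsupp := by
    have := h.ratio X hX (Fin.cons e x) (Fin.cons e x') i.succ
      (Fin.cases (fun _ => by simp) fun j hj => by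
        simpa using hxx' j (fun hh => hj (congrArg _ hh)))
      (by simpa using hi) hx hx'
      (by
        rw [union_range_cons, union_range_cons]
        exact hsupp.trans (union_subset_union_left _ (subset_insert _ _)))
    simpa using this

theorem exists_circuit_of_not_indep {S : Set E} (h : ¬ M.underlying.Indep S) :
    ∃ X ∈ M.circuits, Function.support X ⊆ S := by
  rw [underlying_indep_iff] at h
  push Not at h
  obtain ⟨_, ⟨X, hX, rfl⟩, hXS⟩ := h
  exact ⟨X, hX, hXS⟩

theorem not_support_subset_of_indep {S : Set E} (h : M.underlying.Indep S) {X : E → WithZero G}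
    (hX : X ∈ M.circuits) : ¬ Function.support X ⊆ S :=
  (M.underlying_indep_iff.1 h) _ ⟨X, hX, rfl⟩

theorem apply_ne_zero_of_indep {S : Set E} (h : M.underlying.Indep S) {X : E → WithZero G}
    (hX : X ∈ M.circuits) {e : E} (hXS : Function.support X ⊆ insert e S) : X e ≠ 0 := by
  intro h0
  refine not_support_subset_of_indep h hX fun f hf => (hXS hf).resolve_left ?_
  rintro rfl
  exact hf h0

theorem eq_smul_of_subset_insert {S : Set E} (h : M.underlying.Indep S) {X Y : E → WithZero G}
    (hX : X ∈ M.circuits) (hY : Y ∈ M.circuits) {e : E}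
    (hXS : Function.support X ⊆ insert e S) (hYS : Function.support Y ⊆ insert e S) :
    ∃ α : G, X = fun e => (α : WithZero G) * Y e := by
  refine M.incomparable X hX Y hY ?_
  rw [(M.isCircuit_support hX).eq_fundCircuit_of_subset h hXS,
    (M.isCircuit_support hY).eq_fundCircuit_of_subset h hYS]

/-- The bases have `m` elements more than `K`. -/
def HasCorank (M : StrongMatroid F E) (K : Set E) (m : ℕ) : Prop :=
  ∀ B, M.underlying.IsBase B → B.ncard = K.ncard + m

theorem HasCorank.insert (hK : M.HasCorank K (m + 1)) {e : E} (he : e ∉ K) :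
    M.HasCorank (insert e K) m := fun B hB => by
  rw [hK B hB, ncard_insert_of_notMem he]; ring

theorem HasCorank.isBase_of_closure_eq (hK : M.HasCorank K m) {S : Set E}
    (hS : S.ncard ≤ K.ncard + m) (h : M.underlying.closure S = univ) :
    M.underlying.IsBase S := by
  obtain ⟨B, hB⟩ := M.underlying.exists_isBase
  exact hB.of_closure_eq (by rwa [hK B hB]) h (M.subset_ground _)

theorem HasCorank.isBase_union_range_iff (hK : M.HasCorank K m) (x : Fin m → E) :
    M.underlying.IsBase (K ∪ range x) ↔ M.underlying.closure (K ∪ range x) = univ :=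
  ⟨fun h => h.closure_eq, hK.isBase_of_closure_eq (ncard_union_range_le K x)⟩

theorem HasCorank.exists_isBase_union_range (hK : M.HasCorank K m) (hKi : M.underlying.Indep K) :
    ∃ x : Fin m → E, M.underlying.IsBase (K ∪ range x) := by
  obtain ⟨B, hB, hKB⟩ := hKi.exists_isBase_superset
  obtain ⟨x, -, hx⟩ := exists_tuple_of_ncard_eq (S := B \ K) (m := m) (by
    rw [ncard_sdiff hKB, hK B hB]; simp)
  refine ⟨x, ?_⟩
  rw [hx, union_sdiff_cancel hKB]
  exact hB

theorem HasCorank.isBase_of_indep (hK : M.HasCorank K 0) (hKi : M.underlying.Indep K) :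
    M.underlying.IsBase K := by
  obtain ⟨x, hx⟩ := hK.exists_isBase_union_range hKi
  have : range x = ∅ := range_eq_empty x
  rwa [this, union_empty] at hx

theorem HasCorank.exists_notMem_closure (hK : M.HasCorank K (m + 1)) :
    ∃ e, e ∉ M.underlying.closure K := by
  by_contra h
  push Not at h
  have := hK _ (hK.isBase_of_closure_eq (S := K) (by omega) (eq_univ_of_forall h))
  omega

theorem notMem_of_notMem_closure {e : E} (he : e ∉ M.underlying.closure K) : e ∉ K :=
  fun h => he (M.underlying.mem_closure_of_mem h (M.subset_ground _))

theorem indep_insert (hK : M.underlying.Indep K) {e : E} (he : e ∉ M.underlying.closure K) :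
    M.underlying.Indep (insert e K) :=
  ((hK.notMem_closure_iff (mem_univ e)).1 he).1

theorem not_indep_insert {e : E} (he : e ∈ M.underlying.closure K) (heK : e ∉ K) :
    ¬ M.underlying.Indep (insert e K) := fun h => by
  have := h.notMem_closure_sdiff_of_mem (mem_insert e K)
  rw [insert_sdiff_self_of_notMem heK] at this
  exact this he

/-- In the contraction of `M` by `K`, the elements `e` and `f` form an independent pair. -/
def IsIndepPair (M : StrongMatroid F E) (K : Set E) (e f : E) : Prop :=
  e ∉ M.underlying.closure K ∧ f ∉ M.underlying.closure (insert e K)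

theorem IsIndepPair.right {e f : E} (h : M.IsIndepPair K e f) : f ∉ M.underlying.closure K :=
  fun hf => h.2 (M.underlying.closure_subset_closure (subset_insert e K) hf)

theorem IsIndepPair.symm {e f : E} (h : M.IsIndepPair K e f) : M.IsIndepPair K f e :=
  ⟨h.right, fun he => h.2 (Matroid.closure_exchange ⟨he, h.1⟩).1⟩

theorem closure_insert_eq {e f : E} (he : e ∉ M.underlying.closure K)
    (hf : f ∉ M.underlying.closure K) (h : ¬ M.IsIndepPair K e f) :
    M.underlying.closure (insert e K) = M.underlying.closure (insert f K) := by
  have hfe : f ∈ M.underlying.closure (insert e K) := by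
    by_contra hh
    exact h ⟨he, hh⟩
  exact (Matroid.closure_insert_congr ⟨hfe, hf⟩).symm

/-- Outside the closure of `K`, failing to be an independent pair means being parallel in the
contraction. Hence independent pairs are the edges of a complete multipartite graph. -/
theorem IsIndepPair.of_not {e f a : E} (ha : a ∉ M.underlying.closure K)
    (hea : ¬ M.IsIndepPair K e a) (h : M.IsIndepPair K e f) : M.IsIndepPair K a f :=
  ⟨ha, by rw [← closure_insert_eq h.1 ha hea]; exact h.2⟩

theorem IsIndepPair.indep (hK : M.underlying.Indep K) {e f : E} (h : M.IsIndepPair K e f) :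
    M.underlying.Indep (insert f (insert e K)) := indep_insert (indep_insert hK h.1) h.2

/-- By induction on the corank, each contraction by `e` has its own scalar `g e`. Antisymmetry
identifies the scalars of an independent pair, and a circuit through both elements those of a
parallel pair. -/
theorem IsCompatible.exists_eq_mul {φ ψ : (Fin m → E) → WithZero G} (hφ : M.IsCompatible K φ)
    (hψ : M.IsCompatible K ψ) (hKi : M.underlying.Indep K) (hK : M.HasCorank K m) :
    ∃ g : G, ∀ x, φ x = (g : WithZero G) * ψ x := by
  induction m generalizing K with
  | zero =>
    have hB := hK.isBase_of_indep hKi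
    have hx : ∀ x : Fin 0 → E, M.underlying.IsBase (K ∪ range x) := fun x => by
      rwa [range_eq_empty x, union_empty]
    obtain ⟨g, hg⟩ := WithZero.ne_zero_iff_exists.1
      (div_ne_zero ((hφ.ne_zero_iff Fin.elim0).2 (hx _)) ((hψ.ne_zero_iff Fin.elim0).2 (hx _)))
    refine ⟨g, fun x => ?_⟩
    rw [Subsingleton.elim x Fin.elim0, hg, div_mul_cancel₀]
    exact (hψ.ne_zero_iff Fin.elim0).2 (hx _)
  | succ m ih =>
    have h1 : ∀ e, ∃ g : G, e ∉ M.underlying.closure K →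
        ∀ x : Fin m → E, φ (Fin.cons e x) = (g : WithZero G) * ψ (Fin.cons e x) := by
      intro e
      by_cases he : e ∈ M.underlying.closure K
      · exact ⟨1, fun h => absurd he h⟩
      · obtain ⟨g, hg⟩ := ih (hφ.cons e) (hψ.cons e) (indep_insert hKi he)
          (hK.insert (notMem_of_notMem_closure he))
        exact ⟨g, fun _ => hg⟩
    choose g hg using h1
    have h2 : ∀ e f, e ∉ M.underlying.closure K → f ∉ M.underlying.closure K → g e = g f := by
      intro e f he hf
      by_cases hef : e = f
      · rw [hef]
      have hcor := hK.insert (notMem_of_notMem_closure he)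
      have hie := indep_insert hKi he
      by_cases hadj : M.IsIndepPair K e f
      · have hfe := notMem_of_notMem_closure hadj.2
        obtain _ | m := m
        -- In corank one `insert e K` is already a base, so no independent pair exists.
        · have := hcor.isBase_of_indep hie
          exact absurd (this.closure_eq ▸ mem_univ f) hadj.2
        · obtain ⟨z, hz⟩ := (hcor.insert hfe).exists_isBase_union_range (hadj.indep hKi)
          rw [← union_range_cons, ← union_range_cons, ← hψ.ne_zero_iff] at hz
          have h3 := hφ.antisymm.cons_cons e f z
          rw [hg e he, hg f hf, hψ.antisymm.cons_cons f e z, Tract.neg, Tract.neg,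
            mul_left_comm, F.eps_mul_eps_mul] at h3
          exact WithZero.coe_inj.1 (mul_right_cancel₀ hz h3)
      -- Parallel elements are completed to bases by the same `z`, and the circuit in `K ∪ {e, f}`
      -- imposes the same ratio on both functions.
      · obtain ⟨z, hz⟩ := hcor.exists_isBase_union_range hie
        have hcl := closure_insert_eq he hf hadj
        have hzf : M.underlying.IsBase (insert f K ∪ range z) := by
          have hcor' := hK.insert (notMem_of_notMem_closure hf)
          rw [hcor'.isBase_union_range_iff]
          exact (Matroid.closure_union_congr_left hcl).symm.trans hz.closure_eq
        have hfe : f ∈ M.underlying.closure (insert e K) := by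
          by_contra h; exact hadj ⟨he, h⟩
        obtain ⟨X, hX, hXs⟩ := exists_circuit_of_not_indep (not_indep_insert hfe (by
          rintro (h | h)
          · exact hef h.symm
          · exact notMem_of_notMem_closure hf h))
        have hXf : X f ≠ 0 := apply_ne_zero_of_indep hie hX hXs
        have hXe : X e ≠ 0 := apply_ne_zero_of_indep (indep_insert hKi hf) hX
          (by rwa [insert_comm])
        rw [← union_range_cons] at hz hzf
        have hsub : Function.support X ⊆ K ∪ range (Fin.cons e z : Fin (m + 1) → E) ∪
            range (Fin.cons f z : Fin (m + 1) → E) := by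
          refine hXs.trans ?_
          rw [Fin.range_cons, Fin.range_cons]
          intro a ha
          simp only [mem_insert_iff, mem_union] at ha ⊢
          tauto
        have key : ∀ {χ : (Fin (m + 1) → E) → WithZero G}, M.IsCompatible K χ →
            X e * χ (Fin.cons e z) = F.neg (X f * χ (Fin.cons f z)) := by
          intro χ hχ
          have := hχ.ratio X hX (Fin.cons e z) (Fin.cons f z) 0
            (Fin.cases (fun h => absurd rfl h) fun j _ => by simp) (by simpa using hef)
            ((hχ.ne_zero_iff _).2 hz) ((hχ.ne_zero_iff _).2 hzf) hsub
          simpa using this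
        have k1 := key hφ
        have k2 := key hψ
        rw [hg e he, hg f hf, mul_left_comm, k2, Tract.neg, Tract.neg, mul_left_comm,
          mul_left_comm (X f)] at k1
        have hne := (hψ.ne_zero_iff _).2 hzf
        have k3 := mul_left_cancel₀ F.eps_ne_zero k1
        exact WithZero.coe_inj.1 (mul_right_cancel₀ (mul_ne_zero hXf hne) k3)
    obtain ⟨e₁, he₁⟩ := hK.exists_notMem_closure
    refine ⟨g e₁, fun x => ?_⟩
    by_cases hx : x 0 ∈ M.underlying.closure K
    -- A tuple whose first entry lies in the closure of `K` does not complete `K` to a base, so both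
    -- functions vanish there.
    · have hnb : ¬ M.underlying.IsBase (K ∪ range x) := by
        intro h
        rw [← Fin.cons_self_tail x, union_range_cons] at h
        have hx0 : x 0 ∉ K := fun hxK => by
          rw [insert_eq_of_mem hxK] at h
          have h4 := ncard_union_range_le K (Fin.tail x)
          have h5 := hK _ h
          omega
        exact not_indep_insert hx hx0 (h.indep.subset subset_union_left)
      rw [← hφ.ne_zero_iff, not_not] at hnb
      have hnb' := hnb
      rw [← not_not (a := φ x = 0), ← ne_eq, hφ.ne_zero_iff, ← hψ.ne_zero_iff, not_not] at hnb'
      rw [hnb, hnb', mul_zero]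
    · have := hg (x 0) hx (Fin.tail x)
      rwa [Fin.cons_self_tail, h2 _ _ hx he₁] at this

end StrongMatroid

/-! ### Cocycles on complete multipartite graphs -/

section Algebra

variable {A : Type*} [CommGroupWithZero A]

/-- The `h`s are circuit ratios with coordinates `x, y, w`; the `k`s compare contractions through
the factors `p, q, s`; `t` is the sign. Multiplied around the triangle, everything but `p * q * s`
cancels. -/
theorem mul_mul_eq_one_of_triangle {t x y w a a' b b' c c' p q s : A} (ht : t ≠ 0) (hx : x ≠ 0)
    (hy : y ≠ 0) (hw : w ≠ 0) (ha : a' ≠ 0) (hb : b' ≠ 0) (hc : c' ≠ 0)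
    (h1 : y * a = t * (w * a')) (h2 : w * b = t * (x * b')) (h3 : x * c = t * (y * c'))
    (k1 : a = t * (p * b')) (k2 : b = t * (q * c')) (k3 : c = t * (s * a')) :
    p * q * s = 1 := by
  rw [k1, mul_left_comm] at h1
  rw [k2, mul_left_comm] at h2
  rw [k3, mul_left_comm] at h3
  have e1 := mul_left_cancel₀ ht h1
  have e2 := mul_left_cancel₀ ht h2
  have e3 := mul_left_cancel₀ ht h3
  have hne : x * y * w * (a' * b' * c') ≠ 0 := by simp [*]
  apply mul_left_cancel₀ hne
  calc x * y * w * (a' * b' * c') * (p * q * s)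
      = (y * (p * b')) * (w * (q * c')) * (x * (s * a')) := by ac_rfl
    _ = (w * a') * (x * b') * (y * c') := by rw [e1, e2, e3]
    _ = _ := by rw [mul_one]; ac_rfl

/-- The same cancellation around a square, with two circuits: coordinates `x, y` belong to one and
`w, v` to the other. -/
theorem mul_mul_mul_eq_one_of_square {t x y w v a b c d a' b' c' d' p q r s : A} (ht : t ≠ 0)
    (hx : x ≠ 0) (hy : y ≠ 0) (hw : w ≠ 0) (hv : v ≠ 0) (ha : a' ≠ 0) (hb : b' ≠ 0)
    (hc : c' ≠ 0) (hd : d' ≠ 0)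
    (h1 : x * a = t * (y * a')) (h2 : w * b = t * (v * b')) (h3 : y * c = t * (x * c'))
    (h4 : v * d = t * (w * d'))
    (k1 : a = t * (p * b')) (k2 : b = t * (q * c')) (k3 : c = t * (r * d'))
    (k4 : d = t * (s * a')) : p * q * r * s = 1 := by
  rw [k1, mul_left_comm] at h1
  rw [k2, mul_left_comm] at h2
  rw [k3, mul_left_comm] at h3
  rw [k4, mul_left_comm] at h4
  have e1 := mul_left_cancel₀ ht h1
  have e2 := mul_left_cancel₀ ht h2
  have e3 := mul_left_cancel₀ ht h3
  have e4 := mul_left_cancel₀ ht h4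
  have hne : x * y * w * v * (a' * b' * c' * d') ≠ 0 := by simp [*]
  apply mul_left_cancel₀ hne
  calc x * y * w * v * (a' * b' * c' * d') * (p * q * r * s)
      = (x * (p * b')) * (w * (q * c')) * (y * (r * d')) * (v * (s * a')) := by ac_rfl
    _ = (y * a') * (v * b') * (x * c') * (w * d') := by rw [e1, e2, e3, e4]
    _ = _ := by rw [mul_one]; ac_rfl

end Algebra

/-- A multiplicative cocycle on a complete multipartite graph is a coboundary. -/
theorem exists_potential_of_multipartite {E A : Type*} [CommGroup A] {adj : E → E → Prop}
    {V : E → Prop} (hV : ∀ e f, adj e f → V e) (hsymm : ∀ e f, adj e f → adj f e)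
    (htrans : ∀ e a f, V a → ¬ adj e a → adj e f → adj a f) {κ : E → E → A}
    (hanti : ∀ e f, adj e f → κ e f * κ f e = 1)
    (htri : ∀ e f g, adj e f → adj f g → adj g e → κ e f * κ f g * κ g e = 1)
    (hsq : ∀ e f a b, ¬ adj e a → ¬ adj f b → adj e f → adj f a → adj a b → adj b e →
      κ e f * κ f a * κ a b * κ b e = 1) :
    ∃ c : E → A, ∀ e f, adj e f → c f = c e * κ e f := by
  classical
  -- If `f` and `b` are adjacent, that diagonal cuts the square into two triangles, so one
  -- nonadjacent diagonal suffices.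
  have hsq' : ∀ e f a b, ¬ adj e a → adj e f → adj f a → adj a b → adj b e →
      κ e f * κ f a * κ a b * κ b e = 1 := by
    intro e f a b hea hef hfa hab hbe
    by_cases hfb : adj f b
    · have h1 := htri e f b hef hfb hbe
      have h2 := htri f a b hfa hab (hsymm _ _ hfb)
      have h3 := hanti f b hfb
      calc κ e f * κ f a * κ a b * κ b e
          = κ e f * κ f a * κ a b * κ b e * (κ f b * κ b f) := by rw [h3, mul_one]
        _ = (κ e f * κ f b * κ b e) * (κ f a * κ a b * κ b f) := by
          simp only [mul_comm, mul_left_comm]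
        _ = 1 := by rw [h1, h2, one_mul]
    · exact hsq e f a b hea hfb hef hfa hab hbe
  by_cases hex : ∃ e₀ b, adj e₀ b
  swap
  · push Not at hex
    exact ⟨fun _ => 1, fun e f h => absurd h (hex e f)⟩
  obtain ⟨e₀, b, hb⟩ := hex
  -- The potential is transport from `e₀`: along the edge to a neighbour, and through the fixed
  -- neighbour `b` to vertices in the part of `e₀`.
  refine ⟨fun x => if adj e₀ x then κ e₀ x else κ e₀ b * κ b x, fun e f hef => ?_⟩
  have hfe := hsymm _ _ hef
  by_cases he : adj e₀ e <;> by_cases hf : adj e₀ f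
  · simp only [he, hf, if_true]
    have h1 := htri e₀ e f he hef (hsymm _ _ hf)
    have h2 := hanti e₀ f hf
    rw [eq_inv_of_mul_eq_one_left h1, eq_inv_of_mul_eq_one_left h2]
  · simp only [he, hf, if_true, if_false]
    have hbf : adj b f := hsymm _ _ (htrans e₀ f b (hV _ _ hfe) hf hb)
    have h1 := hsq' e₀ b f e hf hb hbf hfe (hsymm _ _ he)
    have h2 := hanti e f hef
    have h3 := hanti e₀ e he
    calc κ e₀ b * κ b f = κ e₀ b * κ b f * (κ e f * κ f e) * (κ e₀ e * κ e e₀) := by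
          rw [h2, h3, mul_one, mul_one]
      _ = (κ e₀ b * κ b f * κ f e * κ e e₀) * (κ e₀ e * κ e f) := by
          simp only [mul_comm, mul_left_comm]
      _ = _ := by rw [h1, one_mul]
  · simp only [he, hf, if_true, if_false]
    have hbe : adj b e := hsymm _ _ (htrans e₀ e b (hV _ _ hef) he hb)
    have h1 := hsq' e₀ b e f he hb hbe hef (hsymm _ _ hf)
    have h3 := hanti e₀ f hf
    calc κ e₀ f = (κ e₀ b * κ b e * κ e f * κ f e₀) * κ e₀ f := by rw [h1, one_mul]
      _ = (κ e₀ b * κ b e * κ e f) * (κ e₀ f * κ f e₀) := by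
          simp only [mul_comm, mul_left_comm]
      _ = _ := by rw [h3, mul_one]
  -- Two vertices both nonadjacent to `e₀` lie in its part and cannot be adjacent to each other.
  · exact absurd (hsymm _ _ (htrans e e₀ f (hV _ _ hb) (fun h => he (hsymm _ _ h)) hef))
      (fun h => hf (hsymm _ _ h))

/-! ### The cocycle condition for the contractions -/

namespace StrongMatroid

variable {G : Type u} [CommGroup G] {F : Tract G} {E : Type v} [Finite E]
  {M : StrongMatroid F E} {K : Set E} {m : ℕ}

theorem IsIndepPair.closure_eq (hK : M.underlying.Indep K) {e f a b : E}
    (hef : M.IsIndepPair K e f) (hab : M.IsIndepPair K a b)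
    (ha : a ∈ M.underlying.closure (insert f (insert e K)))
    (hb : b ∈ M.underlying.closure (insert f (insert e K))) :
    M.underlying.closure (insert b (insert a K)) =
      M.underlying.closure (insert f (insert e K)) := by
  have hI := hef.indep hK
  have hJ := hab.indep hK
  have hKs : K ⊆ M.underlying.closure (insert f (insert e K)) :=
    M.underlying.subset_closure_of_subset ((subset_insert _ _).trans (subset_insert _ _))
      (M.subset_ground _)
  obtain ⟨B, hB, hJB⟩ := hJ.subset_isBasis_of_subset
    (insert_subset hb (insert_subset ha hKs)) (M.subset_ground _)
  have hcard := hB.encard_eq_encard hI.isBasis_closure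
  have hcount : ∀ {c d}, M.IsIndepPair K c d → (insert d (insert c K)).ncard = K.ncard + 2 := by
    intro c d h
    rw [ncard_insert_of_notMem (notMem_of_notMem_closure h.2),
      ncard_insert_of_notMem (notMem_of_notMem_closure h.1)]
  have : insert b (insert a K) = B := eq_of_subset_of_ncard_le hJB (by
    rw [hcount hab, ← hcount hef, ncard_def, ncard_def, hcard]) (toFinite _)
  rw [this, hB.closure_eq_closure, Matroid.closure_closure]

section Gluing

variable {φ : E → (Fin (m + 1) → E) → WithZero G} {κ : E → E → G}

/-- Two independent pairs in the same rank-two flat over `K` span it, so one `z` completes both to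
bases. All values compared in the cocycle condition can thus share a single `z`. -/
theorem contraction_ne_zero (hK : M.underlying.Indep K) (hcor : M.HasCorank K (m + 2))
    (hφ : ∀ e, e ∉ M.underlying.closure K → M.IsCompatible (insert e K) (φ e))
    {e f a b : E} (hef : M.IsIndepPair K e f) (hab : M.IsIndepPair K a b)
    (ha : a ∈ M.underlying.closure (insert f (insert e K)))
    (hb : b ∈ M.underlying.closure (insert f (insert e K))) {z : Fin m → E}
    (hz : M.underlying.IsBase (insert f (insert e K) ∪ range z)) :
    φ a (Fin.cons b z) ≠ 0 := by
  have hcl := hef.closure_eq hK hab ha hb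
  have hcor' := (hcor.insert (notMem_of_notMem_closure hab.1)).insert
    (notMem_of_notMem_closure hab.2)
  rw [(hφ a hab.1).ne_zero_iff, union_range_cons, hcor'.isBase_union_range_iff]
  exact (Matroid.closure_union_congr_left hcl).trans hz.closure_eq

theorem contraction_ratio
    (hφ : ∀ e, e ∉ M.underlying.closure K → M.IsCompatible (insert e K) (φ e))
    {a b c : E} (ha : a ∉ M.underlying.closure K) {X : E → WithZero G} (hX : X ∈ M.circuits)
    (hbc : b ≠ c) {z : Fin m → E} (hb : φ a (Fin.cons b z) ≠ 0) (hc : φ a (Fin.cons c z) ≠ 0)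
    (hXs : Function.support X ⊆ insert c (insert b (insert a K))) :
    X b * φ a (Fin.cons b z) = F.eps * (X c * φ a (Fin.cons c z)) := by
  have := (hφ a ha).ratio X hX (Fin.cons b z) (Fin.cons c z) 0
    (Fin.cases (fun h => absurd rfl h) fun j _ => by simp) (by simpa using hbc) hb hc (by
      refine hXs.trans ?_
      rw [Fin.range_cons, Fin.range_cons]
      intro x hx
      simp only [mem_insert_iff, mem_union] at hx ⊢
      tauto)
  simpa [Tract.neg] using this

/-- The scaling factors between the contractions by the elements `e` and `f` of an independent
pair satisfy the cocycle condition. -/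
theorem exists_scaling (hK : M.underlying.Indep K) (hcor : M.HasCorank K (m + 2))
    (hφ : ∀ e, e ∉ M.underlying.closure K → M.IsCompatible (insert e K) (φ e))
    (hκ : ∀ e f, M.IsIndepPair K e f → ∀ z : Fin m → E,
      φ e (Fin.cons f z) = F.neg ((κ e f : WithZero G) * φ f (Fin.cons e z))) :
    ∃ c : E → G, ∀ e f, M.IsIndepPair K e f → c f = c e * κ e f := by
  have hmem : ∀ {S : Set E} {e}, e ∈ S → e ∈ M.underlying.closure S := fun {S e} h =>
    M.underlying.mem_closure_of_mem h (M.subset_ground _)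
  have hext : ∀ e f, M.IsIndepPair K e f → ∃ z : Fin m → E,
      M.underlying.IsBase (insert f (insert e K) ∪ range z) := fun e f h =>
    ((hcor.insert (notMem_of_notMem_closure h.1)).insert
      (notMem_of_notMem_closure h.2)).exists_isBase_union_range (h.indep hK)
  have hne : ∀ {e f}, M.IsIndepPair K e f → e ≠ f := by
    rintro e f h rfl
    exact h.2 (hmem (mem_insert _ _))
  have hanti : ∀ c d, M.IsIndepPair K c d → κ c d * κ d c = 1 := by
    intro c d hcd
    obtain ⟨z, hz⟩ := hext c d hcd
    have h0 := contraction_ne_zero hK hcor hφ hcd hcd (hmem (by simp)) (hmem (by simp)) hz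
    have h1 := hκ c d hcd z
    rw [hκ d c hcd.symm z, Tract.neg, Tract.neg, mul_left_comm, F.eps_mul_eps_mul,
      ← mul_assoc] at h1
    have := (mul_eq_right₀ h0).1 h1.symm
    rw [← WithZero.coe_mul] at this
    exact WithZero.coe_inj.1 this
  refine exists_potential_of_multipartite (V := fun e => e ∉ M.underlying.closure K)
    (fun e f h => h.1) (fun e f h => h.symm) (fun e a f ha hea hef => hef.of_not ha hea)
    hanti ?_ ?_
  · intro e f g hef hfg hge
    -- If `g` lies in the flat of `e` and `f`, a circuit in `K ∪ {e, f, g}` is nonzero at all three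
    -- elements, since any two are independent, and supplies the three ratios.
    by_cases hg : g ∈ M.underlying.closure (insert f (insert e K))
    · obtain ⟨z, hz⟩ := hext e f hef
      have hnz : ∀ {a b}, M.IsIndepPair K a b → (a = e ∨ a = f ∨ a = g) →
          (b = e ∨ b = f ∨ b = g) → φ a (Fin.cons b z) ≠ 0 := by
        intro a b hab ha hb
        have hall : ∀ {a}, (a = e ∨ a = f ∨ a = g) →
            a ∈ M.underlying.closure (insert f (insert e K)) := by
          rintro a (rfl | rfl | rfl)
          exacts [hmem (by simp), hmem (by simp), hg]
        exact contraction_ne_zero hK hcor hφ hef hab (hall ha) (hall hb) hz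
      obtain ⟨X, hX, hXs⟩ := exists_circuit_of_not_indep (not_indep_insert hg (by
        rintro (h | h | h)
        · exact hne hfg h.symm
        · exact hne hge h
        · exact notMem_of_notMem_closure hge.1 h))
      have hXs2 : Function.support X ⊆ insert e (insert g (insert f K)) := by
        refine hXs.trans fun x hx => ?_
        simp only [mem_insert_iff] at hx ⊢
        tauto
      have hXs3 : Function.support X ⊆ insert f (insert e (insert g K)) := by
        refine hXs.trans fun x hx => ?_
        simp only [mem_insert_iff] at hx ⊢
        tauto
      have hXg := apply_ne_zero_of_indep (hef.indep hK) hX hXs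
      have hXe := apply_ne_zero_of_indep (hfg.indep hK) hX hXs2
      have hXf := apply_ne_zero_of_indep (hge.indep hK) hX hXs3
      have := mul_mul_eq_one_of_triangle F.eps_ne_zero hXe hXf hXg
        (hnz hge.symm (by simp) (by simp)) (hnz hef.symm (by simp) (by simp))
        (hnz hfg.symm (by simp) (by simp))
        (contraction_ratio hφ hef.1 hX (hne hfg) (hnz hef (by simp) (by simp))
          (hnz hge.symm (by simp) (by simp)) hXs)
        (contraction_ratio hφ hfg.1 hX (hne hge) (hnz hfg (by simp) (by simp))
          (hnz hef.symm (by simp) (by simp)) hXs2)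
        (contraction_ratio hφ hge.1 hX (hne hef) (hnz hge (by simp) (by simp))
          (hnz hfg.symm (by simp) (by simp)) hXs3)
        (hκ e f hef z) (hκ f g hfg z) (hκ g e hge z)
      rw [← WithZero.coe_mul, ← WithZero.coe_mul] at this
      exact WithZero.coe_inj.1 this
    -- Otherwise `e, f, g` extend to a base. Each cyclic rotation of them consists of two
    -- transpositions, so the signs cancel and only a factor `κ` remains.
    · have hcor2 := (hcor.insert (notMem_of_notMem_closure hef.1)).insert
        (notMem_of_notMem_closure hef.2)
      obtain _ | m := m
      · have := hcor2.isBase_of_indep (hef.indep hK)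
        exact absurd (this.closure_eq ▸ mem_univ g) hg
      obtain ⟨z, hz⟩ := (hcor2.insert (notMem_of_notMem_closure hg)).exists_isBase_union_range
        (indep_insert (hef.indep hK) hg)
      have h0 : φ e (Fin.cons f (Fin.cons g z)) ≠ 0 := by
        rw [(hφ e hef.1).ne_zero_iff, union_range_cons, union_range_cons]
        exact hz
      have hrot : ∀ a b c, M.IsIndepPair K a b → M.IsIndepPair K b c →
          φ a (Fin.cons b (Fin.cons c z)) = (κ a b : WithZero G) *
            φ b (Fin.cons c (Fin.cons a z)) := fun a b c hab hbc => by
        rw [hκ a b hab, (hφ b hbc.1).antisymm.cons_cons a c, Tract.neg, Tract.neg,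
          mul_left_comm, F.eps_mul_eps_mul]
      have key : φ e (Fin.cons f (Fin.cons g z)) =
          (κ e f * κ f g * κ g e : G) * φ e (Fin.cons f (Fin.cons g z)) := by
        rw [WithZero.coe_mul, WithZero.coe_mul, mul_assoc, mul_assoc, ← hrot g e f hge hef,
          ← hrot f g e hfg hge, ← hrot e f g hef hfg]
      have := (mul_eq_right₀ h0).1 key.symm
      exact WithZero.coe_inj.1 this
  · intro e f a b hea hfb hef hfa hab hbe
    by_cases heq : e = a
    · subst heq
      rw [hanti e f hef, one_mul, hanti e b hab]
    by_cases hfeq : f = b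
    · subst hfeq
      rw [mul_assoc (κ e f), hanti f a hfa, mul_one, hanti e f hef]
    obtain ⟨z, hz⟩ := hext e f hef
    have hcle := closure_insert_eq hef.1 hab.1 hea
    have hclf := closure_insert_eq hfa.1 hbe.1 hfb
    have hae : a ∈ M.underlying.closure (insert e K) := by rw [hcle]; exact hmem (by simp)
    have hbf : b ∈ M.underlying.closure (insert f K) := by rw [hclf]; exact hmem (by simp)
    have hall : ∀ {x}, (x = e ∨ x = f ∨ x = a ∨ x = b) →
        x ∈ M.underlying.closure (insert f (insert e K)) := by
      rintro x (rfl | rfl | rfl | rfl)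
      · exact hmem (by simp)
      · exact hmem (by simp)
      · exact M.underlying.closure_subset_closure (subset_insert _ _) hae
      · exact M.underlying.closure_subset_closure (insert_subset_insert (subset_insert _ _)) hbf
    have hnz : ∀ {x y}, M.IsIndepPair K x y → (x = e ∨ x = f ∨ x = a ∨ x = b) →
        (y = e ∨ y = f ∨ y = a ∨ y = b) → φ x (Fin.cons y z) ≠ 0 := fun h hx hy =>
      contraction_ne_zero hK hcor hφ hef h (hall hx) (hall hy) hz
    -- The square has two parallel pairs: `X` is a circuit through `f` and `b`, and `X'` one through
    -- `e` and `a`.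
    obtain ⟨X, hX, hXs⟩ := exists_circuit_of_not_indep (not_indep_insert hbf (by
      rintro (h | h)
      · exact hfeq h.symm
      · exact notMem_of_notMem_closure hbe.1 h))
    obtain ⟨X', hX', hXs'⟩ := exists_circuit_of_not_indep (not_indep_insert hae (by
      rintro (h | h)
      · exact heq h.symm
      · exact notMem_of_notMem_closure hab.1 h))
    have hXb := apply_ne_zero_of_indep (indep_insert hK hfa.1) hX hXs
    have hXf := apply_ne_zero_of_indep (indep_insert hK hbe.1) hX (insert_comm b f K ▸ hXs)
    have hXa := apply_ne_zero_of_indep (indep_insert hK hef.1) hX' hXs'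
    have hXe := apply_ne_zero_of_indep (indep_insert hK hab.1) hX' (insert_comm a e K ▸ hXs')
    have hsub : ∀ {S : Set E} {x y w}, S ⊆ insert x (insert y K) →
        S ⊆ insert x (insert y (insert w K)) := fun h =>
      h.trans (insert_subset_insert (insert_subset_insert (subset_insert _ _)))
    have := mul_mul_mul_eq_one_of_square F.eps_ne_zero hXf hXb hXa hXe
        (hnz hbe.symm (by simp) (by simp)) (hnz hef.symm (by simp) (by simp))
        (hnz hfa.symm (by simp) (by simp)) (hnz hab.symm (by simp) (by simp))
        (contraction_ratio hφ hef.1 hX hfeq (hnz hef (by simp) (by simp))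
          (hnz hbe.symm (by simp) (by simp)) (hsub hXs))
        (contraction_ratio hφ hfa.1 hX' (Ne.symm heq) (hnz hfa (by simp) (by simp))
          (hnz hef.symm (by simp) (by simp)) (hsub (insert_comm a e K ▸ hXs')))
        (contraction_ratio hφ hab.1 hX (Ne.symm hfeq) (hnz hab (by simp) (by simp))
          (hnz hfa.symm (by simp) (by simp)) (hsub (insert_comm b f K ▸ hXs)))
        (contraction_ratio hφ hbe.1 hX' heq (hnz hbe (by simp) (by simp))
          (hnz hab.symm (by simp) (by simp)) (hsub hXs'))
        (hκ e f hef z) (hκ f a hfa z) (hκ a b hab z) (hκ b e hbe z)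
    rw [← WithZero.coe_mul, ← WithZero.coe_mul, ← WithZero.coe_mul] at this
    exact WithZero.coe_inj.1 this

end Gluing

end StrongMatroid

/-! ### Existence of compatible functions -/

namespace StrongMatroid

variable {G : Type u} [CommGroup G] {F : Tract G} {E : Type v}
  {M : StrongMatroid F E} {K : Set E} {m : ℕ}

/-- Rescaling a vector to prescribe one coordinate. -/
theorem exists_smul_eq {X : E → WithZero G} (hX : X ∈ M.circuits) {e : E} (he : X e ≠ 0)
    {a : WithZero G} (ha : a ≠ 0) :
    ∃ Y ∈ M.circuits, Function.support Y = Function.support X ∧ Y e = a := by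
  obtain ⟨α, hα⟩ := WithZero.ne_zero_iff_exists.1 (div_ne_zero ha he)
  refine ⟨_, M.smul_mem X hX α, Tract.support_coe_mul X α, ?_⟩
  simp only [hα]
  exact div_mul_cancel₀ _ he

variable [Finite E]

/-- All elements outside the closure of `K` are parallel, so circuits through a fixed `e₀` determine
`u`. Eliminating `e₀` between the circuits for `e` and `f` shows that `u` has the right ratio on
every pair. -/
theorem exists_coordinates_of_corank_one (hKi : M.underlying.Indep K) (hK : M.HasCorank K 1) :
    ∃ u : E → WithZero G, (∀ e, e ∉ M.underlying.closure K → u e ≠ 0) ∧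
      ∀ e f, e ∉ M.underlying.closure K → f ∉ M.underlying.closure K → e ≠ f →
        ∀ X ∈ M.circuits, Function.support X ⊆ insert f (insert e K) →
          X e * u e = F.neg (X f * u f) := by
  classical
  obtain ⟨e₀, he₀⟩ := hK.exists_notMem_closure
  have hspan : ∀ e, e ∉ M.underlying.closure K → M.underlying.closure (insert e K) = univ :=
    fun e he => ((hK.insert (notMem_of_notMem_closure he)).isBase_of_indep
      (indep_insert hKi he)).closure_eq
  have hcirc : ∀ e f, e ∉ M.underlying.closure K → f ∉ M.underlying.closure K → e ≠ f →
      ∃ X ∈ M.circuits, Function.support X ⊆ insert f (insert e K) := by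
    intro e f he hf hef
    refine exists_circuit_of_not_indep (not_indep_insert (hspan e he ▸ mem_univ f) ?_)
    rintro (h | h)
    · exact hef h.symm
    · exact notMem_of_notMem_closure hf h
  have hne : ∀ {e f}, e ∉ M.underlying.closure K → f ∉ M.underlying.closure K →
      ∀ X ∈ M.circuits, Function.support X ⊆ insert f (insert e K) → X e ≠ 0 ∧ X f ≠ 0 :=
    fun he hf X hX hXs => ⟨apply_ne_zero_of_indep (indep_insert hKi hf) hX
      (insert_comm _ _ K ▸ hXs), apply_ne_zero_of_indep (indep_insert hKi he) hX hXs⟩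
  -- the coordinates relative to `e₀`
  have hu : ∀ e, ∃ u : WithZero G, e ∉ M.underlying.closure K → u ≠ 0 ∧ (e = e₀ → u = 1) ∧
      (e ≠ e₀ → ∀ X ∈ M.circuits, Function.support X ⊆ insert e₀ (insert e K) →
        X e * u = F.neg (X e₀)) := by
    intro e
    by_cases he : e ∈ M.underlying.closure K
    · exact ⟨1, fun h => absurd he h⟩
    by_cases hee : e = e₀
    · exact ⟨1, fun _ => ⟨one_ne_zero, fun _ => rfl, fun h => absurd hee h⟩⟩
    obtain ⟨X, hX, hXs⟩ := hcirc e e₀ he he₀ hee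
    obtain ⟨hXe, hXe₀⟩ := hne he he₀ X hX hXs
    refine ⟨F.neg (X e₀) / X e, fun _ => ⟨div_ne_zero ((F.neg_ne_zero_iff _).2 hXe₀) hXe,
      fun h => absurd h hee, fun _ Y hY hYs => ?_⟩⟩
    obtain ⟨α, rfl⟩ := eq_smul_of_subset_insert (indep_insert hKi he) hY hX hYs hXs
    simp only
    rw [mul_assoc, mul_div_cancel₀ _ hXe, Tract.neg, Tract.neg, mul_left_comm]
  choose u hu using hu
  have hu₀ : u e₀ = 1 := (hu e₀ he₀).2.1 rfl
  refine ⟨u, fun e he => (hu e he).1, fun e f he hf hef X hX hXs => ?_⟩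
  by_cases hfe₀ : f = e₀
  · subst hfe₀
    rw [(hu e he).2.2 hef X hX hXs, hu₀, mul_one]
  by_cases hee₀ : e = e₀
  · subst hee₀
    rw [Tract.eq_neg_comm, (hu f hf).2.2 (Ne.symm hef) X hX (insert_comm f e K ▸ hXs), hu₀,
      mul_one]
  obtain ⟨X₁, hX₁, hX₁s⟩ := hcirc e e₀ he he₀ hee₀
  obtain ⟨hX₁e, hX₁e₀⟩ := hne he he₀ X₁ hX₁ hX₁s
  obtain ⟨X₂', hX₂', hX₂s'⟩ := hcirc f e₀ hf he₀ hfe₀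
  obtain ⟨X₂, hX₂, hX₂s, hX₂e₀⟩ := exists_smul_eq hX₂' (hne hf he₀ X₂' hX₂' hX₂s').2
    ((F.neg_ne_zero_iff _).2 hX₁e₀)
  rw [← hX₂s] at hX₂s'
  have hX₁f : X₁ f = 0 := by
    by_contra h
    rcases hX₁s h with h | h | h
    · exact hfe₀ h
    · exact hef h.symm
    · exact notMem_of_notMem_closure hf h
  have hX₂e : X₂ e = 0 := by
    by_contra h
    rcases hX₂s' h with h | h | h
    · exact hee₀ h
    · exact hef h
    · exact notMem_of_notMem_closure he h
  -- The circuits are scaled to be opposite at `e₀`, and `insert e₀ K` bounds the nullity of their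
  -- union by two. The result agrees with `X₁` at `e` and with `X₂` at `f`.
  obtain ⟨Z, hZ, hZ0, hZN⟩ := M.elimination_of_encard_le (k := 1) (Xs := fun _ => X₂) (X := X₁)
    (e := fun _ => e₀) (e' := e) (B := insert f (insert e (insert e₀ K))) (I := insert e₀ K)
    hX₁ (fun _ => hX₂) hX₁e (fun _ => hX₂e)
    (fun i j hij => absurd (Subsingleton.elim j i) hij)
    (fun _ => by rw [hX₂e₀, F.neg_neg]) (fun _ => hX₁e₀)
    (hX₁s.trans (by intro x hx; simp only [mem_insert_iff] at hx ⊢; tauto))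
    (fun _ => hX₂s'.trans (by intro x hx; simp only [mem_insert_iff] at hx ⊢; tauto))
    (indep_insert hKi he₀) ((subset_insert _ _).trans (subset_insert _ _)) (by
      refine (encard_insert_le _ _).trans ?_
      refine (add_le_add_left (encard_insert_le _ _) _).trans ?_
      rw [add_assoc]
      norm_num)
  simp only [Finset.univ_unique, Finset.sum_singleton] at hZN
  have hZe : X₁ e = Z e := by
    have := hZN e
    rwa [hX₂e, map_zero, zero_add, F.formal_add_formal_mem_iff, F.neg_neg] at this
  have hZf : X₂ f = Z f := by
    have := hZN f
    rwa [hX₁f, map_zero, add_zero, F.formal_add_formal_mem_iff, F.neg_neg] at this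
  have hZs : Function.support Z ⊆ insert f (insert e K) := by
    intro x hx
    by_contra hxS
    simp only [mem_insert_iff, not_or] at hxS
    have hxe₀ : x ≠ e₀ := by
      rintro rfl
      exact hx (hZ0 0)
    have h1 : X₁ x = 0 := by
      by_contra h
      rcases hX₁s h with h | h | h
      · exact hxe₀ h
      · exact hxS.2.1 h
      · exact hxS.2.2 h
    have h2 : X₂ x = 0 := by
      by_contra h
      rcases hX₂s' h with h | h | h
      · exact hxe₀ h
      · exact hxS.1 h
      · exact hxS.2.2 h
    have := hZN x
    rw [h1, h2, map_zero, zero_add, zero_add, F.formal_mem_iff] at this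
    exact (F.neg_ne_zero_iff _).2 hx this
  obtain ⟨α, rfl⟩ := eq_smul_of_subset_insert (indep_insert hKi he) hX hZ hXs hZs
  have k1 := (hu e he).2.2 hee₀ X₁ hX₁ hX₁s
  have k2 := (hu f hf).2.2 hfe₀ X₂ hX₂ hX₂s'
  rw [hX₂e₀, F.neg_neg, hZf] at k2
  rw [hZe] at k1
  simp only
  rw [mul_assoc, mul_assoc, k1, k2, Tract.neg, Tract.neg, mul_left_comm]

theorem exists_isCompatible_of_corank_one (hKi : M.underlying.Indep K) (hK : M.HasCorank K 1) :
    ∃ φ : (Fin 1 → E) → WithZero G, M.IsCompatible K φ := by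
  classical
  obtain ⟨u, hu, hratio⟩ := exists_coordinates_of_corank_one hKi hK
  let φ : (Fin 1 → E) → WithZero G := fun x =>
    if x 0 ∈ M.underlying.closure K then 0 else u (x 0)
  have hφ0 : ∀ x, φ x ≠ 0 ↔ x 0 ∉ M.underlying.closure K := by
    intro x
    by_cases h : x 0 ∈ M.underlying.closure K
    · simp [φ, h]
    · simp [φ, h, hu]
  have hφ1 : ∀ x, φ x ≠ 0 → φ x = u (x 0) := fun x hx => if_neg ((hφ0 x).1 hx)
  have hrange : ∀ x : Fin 1 → E, K ∪ range x = insert (x 0) K := by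
    intro x
    rw [range_unique, union_singleton]
    rfl
  refine ⟨φ, fun x i j hij => absurd (Subsingleton.elim i j) hij, fun x => ?_, ?_⟩
  · rw [hφ0, hrange]
    constructor
    · intro h
      exact (hK.insert (notMem_of_notMem_closure h)).isBase_of_indep (indep_insert hKi h)
    · intro h hx
      have hxK : x 0 ∉ K := fun h' => by
        rw [insert_eq_of_mem h'] at h
        have := hK _ h
        omega
      exact not_indep_insert hx hxK h.indep
  · intro X hX x x' i _ hi hx hx' hXs
    obtain rfl : i = 0 := Subsingleton.elim _ _
    rw [hφ1 x hx, hφ1 x' hx']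
    refine hratio _ _ ((hφ0 x).1 hx) ((hφ0 x').1 hx') hi X hX (hXs.trans ?_)
    rw [hrange, range_unique, union_singleton]
    exact subset_rfl

/-- The functions `φ e`, rescaled by `c e`, become the slices of one function. The equation `c f = c
e * κ e f` is exactly antisymmetry in the first two arguments; the other properties are inherited
from the slices. -/
theorem exists_isCompatible_succ (hKi : M.underlying.Indep K) (hK : M.HasCorank K (m + 2))
    (ih : ∀ e, e ∉ M.underlying.closure K →
      ∃ φ : (Fin (m + 1) → E) → WithZero G, M.IsCompatible (insert e K) φ) :
    ∃ φ : (Fin (m + 2) → E) → WithZero G, M.IsCompatible K φ := by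
  classical
  have ih' : ∀ e, ∃ φ : (Fin (m + 1) → E) → WithZero G,
      e ∉ M.underlying.closure K → M.IsCompatible (insert e K) φ := fun e => by
    by_cases he : e ∈ M.underlying.closure K
    · exact ⟨0, fun h => absurd he h⟩
    · obtain ⟨φ, hφ⟩ := ih e he
      exact ⟨φ, fun _ => hφ⟩
  choose φ hφ using ih'
  have hκ : ∀ e f, ∃ κ : G, M.IsIndepPair K e f → ∀ z : Fin m → E,
      φ e (Fin.cons f z) = F.neg ((κ : WithZero G) * φ f (Fin.cons e z)) := by
    intro e f
    by_cases hef : M.IsIndepPair K e f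
    swap
    · exact ⟨1, fun h => absurd h hef⟩
    have h1 := (hφ e hef.1).cons f
    have h2 := (hφ f hef.right).cons e
    rw [insert_comm] at h2
    obtain ⟨g, hg⟩ := h1.exists_eq_mul h2 (hef.indep hKi)
      ((hK.insert (notMem_of_notMem_closure hef.1)).insert (notMem_of_notMem_closure hef.2))
    -- The factor `ε` cancels the sign built into the definition of `κ`.
    refine ⟨F.eps * g, fun _ z => ?_⟩
    rw [hg z, Tract.neg, WithZero.coe_mul, mul_assoc, F.eps_mul_eps_mul]
  choose κ hκ using hκ
  obtain ⟨c, hc⟩ := exists_scaling hKi hK hφ hκ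
  let Φ : (Fin (m + 2) → E) → WithZero G := fun x =>
    if x 0 ∈ M.underlying.closure K then 0 else (c (x 0) : WithZero G) * φ (x 0) (Fin.tail x)
  have hΦ0 : ∀ {e} (x : Fin (m + 1) → E), e ∈ M.underlying.closure K →
      Φ (Fin.cons e x) = 0 := fun x he => by simp [Φ, he]
  have hΦ1 : ∀ {e} (x : Fin (m + 1) → E), e ∉ M.underlying.closure K →
      Φ (Fin.cons e x) = (c e : WithZero G) * φ e x := fun x he => by simp [Φ, he]
  have hne : ∀ x, Φ x ≠ 0 ↔ M.underlying.IsBase (K ∪ range x) := by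
    intro x
    rw [← Fin.cons_self_tail x, union_range_cons]
    by_cases he : x 0 ∈ M.underlying.closure K
    · rw [hΦ0 _ he]
      simp only [ne_eq, not_true, false_iff]
      intro h
      have hxK : x 0 ∉ K := fun h' => by
        rw [insert_eq_of_mem h'] at h
        have := hK _ h
        have := ncard_union_range_le K (Fin.tail x)
        omega
      exact not_indep_insert he hxK (h.indep.subset subset_union_left)
    · rw [hΦ1 _ he, ← (hφ _ he).ne_zero_iff]
      simp
  have hpair : ∀ {e f} {x : Fin m → E}, Φ (Fin.cons e (Fin.cons f x)) ≠ 0 →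
      M.IsIndepPair K e f := by
    intro e f x h
    have he : e ∉ M.underlying.closure K := fun he => h (hΦ0 _ he)
    refine ⟨he, fun hf => ?_⟩
    rw [hne, union_range_cons, union_range_cons] at h
    have hfe : f ∉ insert e K := fun h' => by
      rw [insert_eq_of_mem h'] at h
      have h1 := hK _ h
      have h2 := ncard_union_range_le (insert e K) x
      rw [ncard_insert_of_notMem (notMem_of_notMem_closure he)] at h2
      omega
    exact not_indep_insert hf hfe (h.indep.subset subset_union_left)
  have hswap : ∀ e f (x : Fin m → E),
      Φ (Fin.cons e (Fin.cons f x)) = F.neg (Φ (Fin.cons f (Fin.cons e x))) := by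
    intro e f x
    by_cases hef : M.IsIndepPair K e f
    · rw [hΦ1 _ hef.1, hΦ1 _ hef.right, hκ e f hef, hc e f hef, Tract.neg, Tract.neg,
        WithZero.coe_mul, mul_left_comm, mul_assoc]
    · have h1 : Φ (Fin.cons e (Fin.cons f x)) = 0 := by
        by_contra h; exact hef (hpair h)
      have h2 : Φ (Fin.cons f (Fin.cons e x)) = 0 := by
        by_contra h; exact hef (hpair h).symm
      rw [h1, h2, Tract.neg, mul_zero]
  have hratio : ∀ X ∈ M.circuits, ∀ (x x' : Fin (m + 2) → E) (i : Fin (m + 1)),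
      (∀ j, j ≠ i.succ → x j = x' j) → x i.succ ≠ x' i.succ → Φ x ≠ 0 → Φ x' ≠ 0 →
      Function.support X ⊆ K ∪ range x ∪ range x' →
      X (x i.succ) * Φ x = F.neg (X (x' i.succ) * Φ x') := by
    intro X hX x x' i hxx' hi hx hx' hXs
    have h0 : x 0 = x' 0 := hxx' 0 (Fin.succ_ne_zero i).symm
    rw [← Fin.cons_self_tail x] at hx hXs ⊢
    rw [← Fin.cons_self_tail x', ← h0] at hx' hXs ⊢
    have he : x 0 ∉ M.underlying.closure K := fun he => hx (hΦ0 _ he)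
    rw [hΦ1 _ he] at hx hx' ⊢
    rw [hΦ1 _ he]
    have := (hφ _ he).ratio X hX (Fin.tail x) (Fin.tail x') i
      (fun j hj => hxx' j.succ fun h => hj (Fin.succ_injective _ h)) hi
      (right_ne_zero_of_mul hx) (right_ne_zero_of_mul hx') (by
        rw [union_range_cons, Fin.range_cons] at hXs
        refine hXs.trans fun a ha => ?_
        simp only [mem_insert_iff, mem_union] at ha ⊢
        tauto)
    simp only [Fin.cons_succ]
    rw [mul_left_comm, this, Tract.neg, Tract.neg]
    simp only [mul_left_comm]
  have hanti : F.IsAntisymm Φ := by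
    refine Tract.IsAntisymm.of_cons (fun e x i j hij => ?_) hswap
    simp only
    by_cases he : e ∈ M.underlying.closure K
    · rw [hΦ0 _ he, hΦ0 _ he, Tract.neg, mul_zero]
    · rw [hΦ1 _ he, hΦ1 _ he, (hφ e he).antisymm x i j hij, Tract.neg, Tract.neg, mul_left_comm]
  refine ⟨Φ, hanti, hne, fun X hX x x' i hxx' hi hx hx' hXs => ?_⟩
  induction i using Fin.cases with
  | succ i => exact hratio X hX x x' i hxx' hi hx hx' hXs
  | zero =>
    -- Swapping the first two arguments moves the exchanged entry from position `0` to position `1`,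
    -- which `hratio` covers.
    have h01 : (0 : Fin (m + 2)) ≠ 1 := by simp
    have hs1 := hanti x 0 1 h01
    have hs2 := hanti x' 0 1 h01
    have hr : ∀ x : Fin (m + 2) → E, range (x ∘ Equiv.swap 0 1) = range x :=
      fun x => (Equiv.swap (0 : Fin (m + 2)) 1).surjective.range_comp x
    have := hratio X hX (x ∘ Equiv.swap 0 1) (x' ∘ Equiv.swap 0 1) 0
      (by
        intro j hj
        refine hxx' _ fun h => hj ?_
        rw [Equiv.swap_apply_eq_iff, Equiv.swap_apply_left] at h
        simpa using h)
      (by simpa using hi) (by rw [hs1]; exact (F.neg_ne_zero_iff _).2 hx)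
      (by rw [hs2]; exact (F.neg_ne_zero_iff _).2 hx') (by rwa [hr, hr])
    rw [hs1, hs2] at this
    simp only [Fin.succ_zero_eq_one, Function.comp_apply, Equiv.swap_apply_right, Tract.neg]
      at this
    rw [mul_left_comm, mul_left_comm (X (x' 0))] at this
    exact mul_left_cancel₀ F.eps_ne_zero this

theorem exists_isCompatible (m : ℕ) : ∀ {K : Set E}, M.underlying.Indep K →
    M.HasCorank K (m + 1) → ∃ φ : (Fin (m + 1) → E) → WithZero G, M.IsCompatible K φ := by
  induction m with
  | zero => exact fun hKi hK => exists_isCompatible_of_corank_one hKi hK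
  | succ m ih =>
    exact fun hKi hK => exists_isCompatible_succ hKi hK fun e he =>
      ih (indep_insert hKi he) (hK.insert (notMem_of_notMem_closure he))

end StrongMatroid

/-! ### Orthogonality and the Grassmann–Plücker relations for compatible functions -/

namespace StrongMatroid

variable {G : Type u} [CommGroup G] {F : Tract G} {E : Type v}

@[ext]
theorem ext {M M' : StrongMatroid F E} (h : M.circuits = M'.circuits) : M = M' := by
  cases M; cases M'; congr

section Finite

variable [Finite E] {M : StrongMatroid F E} {K : Set E} {m : ℕ}

/-- The ratio property without the assumption that both tuples are bases. -/
theorem IsCompatible.mul_eq_neg_mul {φ : (Fin m → E) → WithZero G} (hφ : M.IsCompatible K φ)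
    (hK : M.HasCorank K m) {X : E → WithZero G} (hX : X ∈ M.circuits) {x x' : Fin m → E}
    {i : Fin m} (hxx' : ∀ j, j ≠ i → x j = x' j)
    (hXs : Function.support X ⊆ K ∪ range x ∪ range x') :
    X (x i) * φ x = F.neg (X (x' i) * φ x') := by
  -- If `X (x i) ≠ 0`, the circuit puts `x i` in the closure of `K ∪ range x'`. Then `x'` spans as
  -- well and `φ x'` cannot vanish.
  have aux : ∀ x x' : Fin m → E, (∀ j, j ≠ i → x j = x' j) →
      Function.support X ⊆ K ∪ range x ∪ range x' → φ x ≠ 0 → φ x' = 0 → X (x i) = 0 := by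
    intro x x' hxx' hXs hx hx'
    by_contra hXx
    have hcl : K ∪ range x' ⊆ M.underlying.closure (K ∪ range x') :=
      M.underlying.subset_closure _ (M.subset_ground _)
    have hsub : Function.support X \ {x i} ⊆ K ∪ range x' := by
      rintro e ⟨he, hei⟩
      rcases hXs he with (h | ⟨j, rfl⟩) | h
      · exact Or.inl h
      · exact Or.inr ⟨j, (hxx' j fun h => hei (by rw [h]; rfl)).symm⟩
      · exact Or.inr h
    have hxi : x i ∈ M.underlying.closure (K ∪ range x') :=
      M.underlying.closure_subset_closure hsub
        ((M.isCircuit_support hX).mem_closure_sdiff_singleton_of_mem hXx)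
    have hall : K ∪ range x ⊆ M.underlying.closure (K ∪ range x') := by
      rintro e (h | ⟨j, rfl⟩)
      · exact hcl (Or.inl h)
      · by_cases hj : j = i
        · rw [hj]; exact hxi
        · rw [hxx' j hj]; exact hcl (Or.inr ⟨j, rfl⟩)
    have h1 := M.underlying.closure_subset_closure_of_subset_closure hall
    rw [((hφ.ne_zero_iff x).1 hx).closure_eq] at h1
    exact (hφ.ne_zero_iff x').2 ((hK.isBase_union_range_iff x').2 (univ_subset_iff.1 h1)) hx'
  by_cases hx : φ x = 0 <;> by_cases hx' : φ x' = 0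
  · rw [hx, hx', mul_zero, mul_zero, Tract.neg, mul_zero]
  · rw [aux x' x (fun j hj => (hxx' j hj).symm) (by rwa [union_right_comm]) hx' hx, hx,
      zero_mul, mul_zero, Tract.neg, mul_zero]
  · rw [aux x x' hxx' hXs hx hx', hx', zero_mul, mul_zero, Tract.neg, mul_zero]
  · by_cases hi : x i = x' i
    · have : x = x' := funext fun j => by
        by_cases hj : j = i
        · rw [hj, hi]
        · exact hxx' j hj
      subst this
      rw [union_assoc, union_self] at hXs
      exact absurd hXs (not_support_subset_of_indep ((hφ.ne_zero_iff x).1 hx).indep hX)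
    · exact hφ.ratio X hX x x' i hxx' hi hx hx' hXs

theorem IsCompatible.mul_cons_eq_neg_mul_cons {φ : (Fin (m + 1) → E) → WithZero G}
    (hφ : M.IsCompatible K φ) (hK : M.HasCorank K (m + 1)) {X : E → WithZero G}
    (hX : X ∈ M.circuits) {a b : E} {z : Fin m → E}
    (hXs : Function.support X ⊆ K ∪ insert a (insert b (range z))) :
    X a * φ (Fin.cons a z) = F.neg (X b * φ (Fin.cons b z)) := by
  have := hφ.mul_eq_neg_mul hK hX (x := Fin.cons a z) (x' := Fin.cons b z) (i := 0)
    (Fin.cases (fun h => absurd rfl h) fun j _ => by simp) (by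
      rw [Fin.range_cons, Fin.range_cons]
      refine hXs.trans fun e he => ?_
      simp only [mem_insert_iff, mem_union] at he ⊢
      tauto)
  simpa using this

theorem IsCompatible.injective_of_ne_zero {φ : (Fin m → E) → WithZero G}
    (hφ : M.IsCompatible ∅ φ) (hK : M.HasCorank ∅ m) {x : Fin m → E} (hx : φ x ≠ 0) :
    Function.Injective x := by
  have h1 := hK _ ((hφ.ne_zero_iff x).1 hx)
  rw [empty_union, ncard_empty, zero_add, ← Nat.card_coe_set_eq] at h1
  have h2 : Function.Injective (rangeFactorization x) := by
    refine ((Nat.bijective_iff_surjective_and_card _).2 ⟨rangeFactorization_surjective, ?_⟩).1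
    rw [h1, Nat.card_fin]
  exact fun i j hij => h2 (Subtype.ext hij)

end Finite

section Orthogonality

variable [Fintype E] {M : StrongMatroid F E} {n : ℕ} {φ : (Fin (n + 1) → E) → WithZero G}

/-- Orthogonality when the circuit is contained in the union of `range y` and the support of
`φ(·, y)`. -/
theorem IsCompatible.sum_mem_of_forall_mem_range (hφ : M.IsCompatible ∅ φ)
    (hK : M.HasCorank ∅ (n + 1)) {X : E → WithZero G} (hX : X ∈ M.circuits) (y : Fin n → E)
    (hXy : ∀ e, X e ≠ 0 → φ (Fin.cons e y) = 0 → e ∈ range y) :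
    ∑ e, Tract.formal (X e * φ (Fin.cons e y)) ∈ F.nullSet := by
  classical
  set Y : E → WithZero G := fun e => φ (Fin.cons e y) with hY
  have hYne : ∀ e, Y e ≠ 0 → e ∉ range y := fun e he =>
    (Fin.cons_injective_iff.1 (hφ.injective_of_ne_zero hK he)).1
  have hYB : ∀ e, Y e ≠ 0 → M.underlying.IsBase (insert e (range y)) := by
    intro e he
    have := (hφ.ne_zero_iff _).1 he
    rwa [empty_union, Fin.range_cons] at this
  set T : Set E := {e | X e ≠ 0 ∧ Y e ≠ 0} with hT
  have hXT : ∀ e, X e ≠ 0 → e ∈ range y ∨ e ∈ T := by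
    intro e he
    by_cases h : Y e = 0
    · exact Or.inl (hXy e he h)
    · exact Or.inr ⟨he, h⟩
  by_cases hT0 : T = ∅
  · have : ∀ e, X e * Y e = 0 := by
      intro e
      by_contra h
      have : e ∈ T := ⟨left_ne_zero_of_mul h, right_ne_zero_of_mul h⟩
      rw [hT0] at this
      exact this
    simp only [hY] at this
    simpa [this] using F.zero_mem
  obtain ⟨e₀, he₀⟩ := nonempty_iff_ne_empty.2 hT0
  have hB₀ := hYB e₀ he₀.2
  -- A circuit does not fit inside the base `insert e₀ (range y)`, so `T` has a second element; it
  -- serves as the private point of `X`.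
  obtain ⟨e₁, he₁, he₁₀⟩ : ∃ e₁ ∈ T, e₁ ≠ e₀ := by
    by_contra hcon
    push Not at hcon
    refine not_support_subset_of_indep hB₀.indep hX fun e he => ?_
    rcases hXT e he with h | h
    · exact Or.inr h
    · exact Or.inl (hcon e h)
  set k := (T \ {e₀, e₁}).ncard with hk
  obtain ⟨t, ht, htr⟩ := exists_tuple_of_ncard_eq hk.symm
  have htT : ∀ i, t i ∈ T \ {e₀, e₁} := fun i => htr ▸ mem_range_self i
  have ht₀ : ∀ i, t i ≠ e₀ := fun i h => (htT i).2 (by simp [h])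
  have ht₁ : ∀ i, t i ≠ e₁ := fun i h => (htT i).2 (by simp [h])
  have hty : ∀ i, t i ∉ range y := fun i => hYne _ (htT i).1.2
  -- the circuits through `t i` in the union of the basis `insert e₀ (range y)` and `{t i}`
  have hXs : ∀ i, ∃ Z ∈ M.circuits, Function.support Z ⊆ insert (t i) (insert e₀ (range y)) ∧
      Z (t i) = F.neg (X (t i)) := by
    intro i
    obtain ⟨Z, hZ, hZs⟩ := exists_circuit_of_not_indep (M := M)
      (S := insert (t i) (insert e₀ (range y))) (by
        refine not_indep_insert (hB₀.closure_eq ▸ mem_univ _) ?_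
        rintro (h | h)
        · exact ht₀ i h
        · exact hty i h)
    obtain ⟨Z', hZ', hZZ', hZt⟩ := exists_smul_eq hZ
      (apply_ne_zero_of_indep hB₀.indep hZ hZs) ((F.neg_ne_zero_iff _).2 (htT i).1.1)
    exact ⟨Z', hZ', hZZ' ▸ hZs, hZt⟩
  choose Xs hXsM hXss hXst using hXs
  have hXs0 : ∀ i f, f ∉ range y → f ≠ e₀ → f ≠ t i → Xs i f = 0 := by
    intro i f h1 h2 h3
    by_contra h
    rcases hXss i h with h | h | h
    · exact h3 h
    · exact h2 h
    · exact h1 h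
  set B : Set E := range (Fin.cons e₁ t : Fin (k + 1) → E) ∪ insert e₀ (range y) with hB
  have hmemB : ∀ i, t i ∈ B := fun i => Or.inl ⟨i.succ, by simp⟩
  have hTB : T ⊆ B := by
    intro e he
    by_cases h0 : e = e₀
    · exact Or.inr (Or.inl h0)
    by_cases h1 : e = e₁
    · exact Or.inl ⟨0, by simp [h1]⟩
    have : e ∈ range t := htr ▸ ⟨he, by simp [h0, h1]⟩
    obtain ⟨i, rfl⟩ := this
    exact hmemB i
  -- All elements of `T` except `e₀` and `e₁` are eliminated at once. `B` exceeds the base by at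
  -- most `k + 1` elements, and `Z` lives on `e₀`, `e₁` and `range y`.
  obtain ⟨Z, hZ, hZt, hZN⟩ := M.elimination_of_encard_le (k := k) (Xs := Xs) (X := X) (e := t)
    (e' := e₁) (B := B) (I := insert e₀ (range y)) hX hXsM he₁.1
    (fun i => hXs0 i e₁ (hYne _ he₁.2) he₁₀ (ht₁ i).symm)
    (fun i j hij => hXs0 j (t i) (hty i) (ht₀ i) fun h => hij (ht h).symm)
    (fun i => by rw [hXst, F.neg_neg]) (fun i => (htT i).1.1)
    (fun e he => (hXT e he).elim (fun h => Or.inr (Or.inr h)) fun h => hTB h)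
    (fun i => (hXss i).trans (insert_subset (hmemB i) subset_union_right))
    hB₀.indep subset_union_right (by
      refine (encard_union_le _ _).trans ?_
      rw [add_comm]
      gcongr
      rw [← image_univ]
      refine (encard_image_le _ _).trans ?_
      simp)
  have hZ₁ : X e₁ = Z e₁ := by
    have := hZN e₁
    rw [Finset.sum_eq_zero fun i _ => by
      rw [hXs0 i e₁ (hYne _ he₁.2) he₁₀ (ht₁ i).symm, map_zero]] at this
    rwa [zero_add, F.formal_add_formal_mem_iff, F.neg_neg] at this
  have hZs : Function.support Z ⊆ ∅ ∪ insert e₀ (insert e₁ (range y)) := by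
    intro f hf
    by_contra hfS
    simp only [empty_union, mem_insert_iff, not_or] at hfS
    have hft : ∀ i, f ≠ t i := by rintro i rfl; exact hf (hZt i)
    have hXf : X f = 0 := by
      by_contra h
      rcases hXT f h with h | h
      · exact hfS.2.2 h
      · have : f ∈ range t := htr ▸ ⟨h, by simp [hfS.1, hfS.2.1]⟩
        obtain ⟨i, hi⟩ := this
        exact hft i hi.symm
    have := hZN f
    rw [Finset.sum_eq_zero fun i _ => by rw [hXs0 i f hfS.2.2 hfS.1 (hft i), map_zero], hXf,
      map_zero, zero_add, zero_add, F.formal_mem_iff] at this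
    exact (F.neg_ne_zero_iff _).2 hf this
  have hZ₀ : F.neg (Z e₀) * Y e₀ = X e₁ * Y e₁ := by
    have := hφ.mul_cons_eq_neg_mul_cons hK hZ hZs
    rw [hZ₁, Tract.neg, mul_assoc]
    simp only [hY]
    rw [this, Tract.neg, F.eps_mul_eps_mul]
  have hXs₀ : ∀ i, Xs i e₀ * Y e₀ = X (t i) * Y (t i) := by
    intro i
    have := hφ.mul_cons_eq_neg_mul_cons hK (hXsM i) (a := e₀) (b := t i) (z := y) (by
      rw [empty_union, insert_comm]; exact hXss i)
    simp only [hY]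
    rw [this, hXst, Tract.neg, Tract.neg, mul_assoc, F.eps_mul_eps_mul]
  -- The elimination relation at `e₀`, multiplied by `Y e₀`, is term by term the orthogonality sum:
  -- `hXs₀` moves each term to `t i` and `hZ₀` moves that of `Z` to `e₁`.
  have hN := F.formal_mul_mem (Y e₀) (hZN e₀)
  have hq : Function.Injective (Fin.cons e₀ (Fin.cons e₁ t : Fin (k + 1) → E) : Fin (k + 2) → E) := by
    rw [Fin.cons_injective_iff, Fin.cons_injective_iff, Fin.range_cons]
    refine ⟨?_, ?_, ht⟩
    · rintro (h | ⟨i, hi⟩)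
      · exact he₁₀ h.symm
      · exact ht₀ i hi
    · rintro ⟨i, hi⟩
      exact ht₁ i hi
  rw [← Fintype.sum_of_injective _ hq (fun i => Tract.formal
    (X ((Fin.cons e₀ (Fin.cons e₁ t : Fin (k + 1) → E) : Fin (k + 2) → E) i) *
      Y ((Fin.cons e₀ (Fin.cons e₁ t : Fin (k + 1) → E) : Fin (k + 2) → E) i))) _ ?_
      (fun i => rfl)]
  · rw [Fin.sum_univ_succ, Fin.sum_univ_succ]
    simp only [Fin.cons_zero, Fin.cons_succ]
    rw [mul_add, mul_add, Finset.mul_sum] at hN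
    simp only [← map_mul, mul_comm (Y e₀)] at hN
    rw [hZ₀, Finset.sum_congr rfl fun i _ => by rw [hXs₀ i]] at hN
    convert hN using 1
    abel
  · intro e he
    have : X e * Y e = 0 := by
      by_contra h
      have heT : e ∈ T := ⟨left_ne_zero_of_mul h, right_ne_zero_of_mul h⟩
      apply he
      rw [Fin.range_cons, Fin.range_cons, htr]
      simp only [mem_insert_iff, mem_sdiff, mem_singleton_iff]
      tauto
    simp only [hY] at this
    rw [this, map_zero]

/-- The circuits of `M` are orthogonal to the vectors `φ(·, y)`. -/
theorem IsCompatible.sum_mem (hφ : M.IsCompatible ∅ φ) (hK : M.HasCorank ∅ (n + 1))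
    {X : E → WithZero G} (hX : X ∈ M.circuits) (y : Fin n → E) :
    ∑ e, Tract.formal (X e * φ (Fin.cons e y)) ∈ F.nullSet := by
  classical
  -- Induction on the number of elements of the support of `X` that lie neither in `range y` nor in
  -- the support of `φ(·, y)`.
  induction hN : {e | X e ≠ 0 ∧ φ (Fin.cons e y) = 0 ∧ e ∉ range y}.ncard
    using Nat.strong_induction_on generalizing y with
  | _ N ih =>
    by_cases hall : ∀ e, X e ≠ 0 → φ (Fin.cons e y) = 0 → e ∈ range y
    · exact hφ.sum_mem_of_forall_mem_range hK hX y hall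
    push Not at hall
    obtain ⟨g, hXg, hYg, hgy⟩ := hall
    by_cases hex : ∃ e, X e ≠ 0 ∧ φ (Fin.cons e y) ≠ 0
    swap
    · push Not at hex
      rw [Finset.sum_eq_zero fun e _ => ?_]
      · exact F.zero_mem
      · by_cases h : X e = 0
        · rw [h, zero_mul, map_zero]
        · rw [hex e h, mul_zero, map_zero]
    obtain ⟨d, hXd, hYd⟩ := hex
    have hbase : ∀ e, φ (Fin.cons e y) ≠ 0 ↔ M.underlying.IsBase (insert e (range y)) := by
      intro e
      rw [hφ.ne_zero_iff, empty_union, Fin.range_cons]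
    have hyi : M.underlying.Indep (range y) := ((hbase d).1 hYd).indep.subset (subset_insert _ _)
    have hyinj : Function.Injective y :=
      (Fin.cons_injective_iff.1 (hφ.injective_of_ne_zero hK hYd)).2
    have hdy : d ∉ range y := (Fin.cons_injective_iff.1 (hφ.injective_of_ne_zero hK hYd)).1
    have hgdep : ¬ M.underlying.Indep (insert g (range y)) := by
      intro h
      refine (hbase g).2 ?_ hYg
      obtain ⟨B, hB, hgB⟩ := h.exists_isBase_superset
      rwa [eq_of_subset_of_ncard_le hgB (by
        rw [hK B hB, ← hK _ ((hbase d).1 hYd), ncard_insert_of_notMem hgy,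
          ncard_insert_of_notMem hdy]) (toFinite B)]
    obtain ⟨A, hA, hAs⟩ := exists_circuit_of_not_indep hgdep
    have hAg : A g ≠ 0 := apply_ne_zero_of_indep hyi hA hAs
    -- `A` is not supported inside `X`: otherwise the supports would coincide, but `d` belongs to
    -- `X` and not to `insert g (range y)`.
    obtain ⟨a, haA, haX⟩ : ∃ a, A a ≠ 0 ∧ X a = 0 := by
      by_contra hcon
      push Not at hcon
      have := (M.isCircuit_support hA).eq_of_subset_isCircuit (M.isCircuit_support hX) hcon
      have hd : d ∈ Function.support A := this ▸ hXd
      rcases hAs hd with h | h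
      · exact hYd (h ▸ hYg)
      · exact hdy h
    obtain ⟨i, rfl⟩ : a ∈ range y := by
      rcases hAs haA with h | h
      · exact absurd (h ▸ haX) hXg
      · exact h
    -- Exchanging `y i` for `g` only rescales `φ(·, y)`, by the ratio from `A`. The bad element `g`
    -- is absorbed into the tuple, and the released `y i` is not in the support of `X`.
    set y' := Function.update y i g with hy'
    have hrel : ∀ e, A g * φ (Fin.cons e y') = F.neg (A (y i) * φ (Fin.cons e y)) := by
      intro e
      have := hφ.mul_eq_neg_mul hK hA (x := Fin.cons e y') (x' := Fin.cons e y) (i := i.succ)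
        (by
          intro j hj
          induction j using Fin.cases with
          | zero => simp
          | succ j =>
            have : j ≠ i := fun h => hj (congrArg _ h)
            simp [hy', this])
        (by
          refine hAs.trans (insert_subset ?_ ?_)
          · exact Or.inl (Or.inr ⟨i.succ, by simp [hy']⟩)
          · rintro _ ⟨j, rfl⟩
            exact Or.inr ⟨j.succ, by simp⟩)
      simpa [hy'] using this
    have hzero : ∀ e, φ (Fin.cons e y') = 0 ↔ φ (Fin.cons e y) = 0 := by
      intro e
      have h1 : A g * φ (Fin.cons e y') = 0 ↔ F.neg (A (y i) * φ (Fin.cons e y)) = 0 := by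
        rw [hrel e]
      simpa [Tract.neg, hAg, haA] using h1
    have hlt : {e | X e ≠ 0 ∧ φ (Fin.cons e y') = 0 ∧ e ∉ range y'}.ncard < N := by
      rw [← hN]
      refine ncard_lt_ncard ⟨?_, fun h => ?_⟩ (toFinite _)
      · rintro e ⟨h1, h2, h3⟩
        refine ⟨h1, (hzero e).1 h2, ?_⟩
        rintro ⟨j, rfl⟩
        by_cases hj : j = i
        · exact h1 (hj ▸ haX)
        · exact h3 ⟨j, by simp [hy', hj]⟩
      · exact (h ⟨hXg, hYg, hgy⟩).2.2 ⟨i, by simp [hy']⟩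
    have h1 := F.formal_mul_mem (A g) (ih _ hlt y' rfl)
    rw [Finset.mul_sum] at h1
    rw [← F.formal_mul_mem_iff (mul_ne_zero F.eps_ne_zero haA), Finset.mul_sum]
    convert h1 using 2 with e
    rw [← map_mul, ← map_mul, mul_left_comm (A g), hrel, Tract.neg]
    congr 1
    ac_rfl

/-- This makes `X` proportional to the signed minors of `x`. Moving `x k` and `x l` to the front of
their tuples leaves the same remainder, so the ratio property applies; omitting `k < l` shifts `l`
by one, which accounts for the sign. -/
theorem IsCompatible.mul_sign_mul_of_lt (hφ : M.IsCompatible ∅ φ) (hK : M.HasCorank ∅ (n + 1))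
    {X : E → WithZero G} (hX : X ∈ M.circuits) {x : Fin (n + 2) → E}
    (hx : Function.Injective x) (hXx : Function.support X ⊆ range x) {k l : Fin (n + 2)}
    (hkl : k < l) :
    X (x k) * (F.sign l * φ (x ∘ l.succAbove)) = X (x l) * (F.sign k * φ (x ∘ k.succAbove)) := by
  have hkl' : (k : ℕ) < l := hkl
  obtain ⟨k', hk'⟩ : ∃ k' : Fin (n + 1), (k' : ℕ) = k := ⟨⟨k, by omega⟩, rfl⟩
  obtain ⟨l', hl'⟩ : ∃ l' : Fin (n + 1), (l' : ℕ) + 1 = l := ⟨⟨l - 1, by omega⟩, by simp; omega⟩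
  have e1 : l.succAbove k' = k := by
    rw [Fin.succAbove_of_castSucc_lt _ _ (by rw [Fin.lt_def, Fin.val_castSucc]; omega)]
    exact Fin.ext hk'
  have e2 : k.succAbove l' = l := by
    rw [Fin.succAbove_of_le_castSucc _ _ (by rw [Fin.le_def, Fin.val_castSucc]; omega)]
    exact Fin.ext hl'
  have e3 : (x ∘ k.succAbove) ∘ l'.succAbove = (x ∘ l.succAbove) ∘ k'.succAbove := by
    ext j
    simp only [Function.comp]
    congr 1
    simp only [Fin.succAbove, Fin.lt_def, Fin.ext_iff]
    split_ifs <;> simp_all <;> omega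
  have h1 := hφ.antisymm.cons_succAbove (x ∘ l.succAbove) k'
  have h2 := hφ.antisymm.cons_succAbove (x ∘ k.succAbove) l'
  rw [e3] at h2
  simp only [Function.comp_apply, e1, e2] at h1 h2
  have h3 := hφ.mul_cons_eq_neg_mul_cons hK hX (a := x k) (b := x l)
    (z := (x ∘ l.succAbove) ∘ k'.succAbove) (by
      rw [range_comp_succAbove (hx.comp (Fin.succAbove_right_injective)),
        range_comp_succAbove hx, Function.comp_apply, e1]
      refine hXx.trans fun e he => ?_
      simp only [empty_union, mem_insert_iff, mem_sdiff, mem_singleton_iff]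
      tauto)
  rw [h1, h2, hk', Tract.neg] at h3
  have hs : F.sign l = F.eps * F.sign l' := by rw [← hl', Tract.sign_succ]
  calc X (x k) * (F.sign l * φ (x ∘ l.succAbove))
      = F.sign l * (F.sign k * F.sign k) * (X (x k) * φ (x ∘ l.succAbove)) := by
        rw [F.sign_mul_sign, mul_one]; ac_rfl
    _ = F.sign l * F.sign k * (X (x k) * (F.sign k * φ (x ∘ l.succAbove))) := by ac_rfl
    _ = F.sign l * F.sign l * (F.sign k * (X (x l) * φ (x ∘ k.succAbove))) := by
        rw [h3]; nth_rw 3 [hs]; ac_rfl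
    _ = _ := by rw [F.sign_mul_sign, one_mul]; ac_rfl

/-- The `n + 2` elements of `x` exceed the rank, so they contain a circuit `X`. The minors are
proportional to `X`, and the relation is a multiple of the orthogonality of `X` to `φ(·, y)`. -/
theorem IsCompatible.relation (hφ : M.IsCompatible ∅ φ) (hK : M.HasCorank ∅ (n + 1))
    (x : Fin (n + 2) → E) (y : Fin n → E) (hx : Function.Injective x) :
    ∑ k : Fin (n + 2), Tract.formal (F.sign ((k : ℕ) + 1) *
      (φ (x ∘ k.succAbove) * φ (Fin.cons (x k) y))) ∈ F.nullSet := by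
  have hdep : ¬ M.underlying.Indep (range x) := by
    intro h
    obtain ⟨B, hB, hxB⟩ := h.exists_isBase_superset
    have h1 := ncard_le_ncard hxB (toFinite B)
    rw [hK B hB, ← image_univ, ncard_image_of_injective _ hx, ncard_univ, Nat.card_fin,
      ncard_empty] at h1
    omega
  obtain ⟨X, hX, hXx⟩ := exists_circuit_of_not_indep hdep
  obtain ⟨_, hk₀⟩ := (M.isCircuit_support hX).nonempty
  obtain ⟨k₀, rfl⟩ := hXx hk₀
  have hprop : ∀ k l : Fin (n + 2), X (x k) * (F.sign l * φ (x ∘ l.succAbove)) =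
      X (x l) * (F.sign k * φ (x ∘ k.succAbove)) := by
    intro k l
    rcases lt_trichotomy k l with h | rfl | h
    · exact hφ.mul_sign_mul_of_lt hK hX hx hXx h
    · rfl
    · exact (hφ.mul_sign_mul_of_lt hK hX hx hXx h).symm
  have hsum := hφ.sum_mem hK hX y
  rw [← Fintype.sum_of_injective x hx (fun k => Tract.formal (X (x k) * φ (Fin.cons (x k) y)))
    _ (fun e he => by
      have : X e = 0 := by
        by_contra h
        exact he (hXx h)
      rw [this, zero_mul, map_zero]) (fun k => rfl)] at hsum
  have := F.formal_mul_mem (F.eps * (F.sign k₀ * φ (x ∘ k₀.succAbove))) hsum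
  rw [← F.formal_mul_mem_iff hk₀, Finset.mul_sum]
  rw [Finset.mul_sum] at this
  convert this using 2 with k
  rw [← map_mul, ← map_mul, Tract.sign_succ]
  congr 1
  calc X (x k₀) * (F.eps * F.sign k * (φ (x ∘ k.succAbove) * φ (Fin.cons (x k) y)))
      = F.eps * (X (x k₀) * (F.sign k * φ (x ∘ k.succAbove))) * φ (Fin.cons (x k) y) := by ac_rfl
    _ = _ := by rw [hprop]; ac_rfl

/-- A compatible function is a Grassmann–Plücker function. -/
def IsCompatible.toGPFunction (hφ : M.IsCompatible ∅ φ) (hK : M.HasCorank ∅ (n + 1)) :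
    GPFunction F E n where
  toFun := φ
  exists_ne_zero := by
    obtain ⟨x, hx⟩ := hK.exists_isBase_union_range M.underlying.empty_indep
    exact ⟨x, (hφ.ne_zero_iff x).2 hx⟩
  map_swap := hφ.antisymm
  map_eq_zero x i j hij hx := by
    by_contra h
    exact hij (hφ.injective_of_ne_zero hK h hx)
  relation x y hx _ := hφ.relation hK x y hx

/-- Orthogonality puts the circuits of `M` among those of `φ`. The underlying matroids agree, and
vectors of the latter set with the same support are proportional, so nothing else occurs. -/
theorem IsCompatible.toStrongMatroid_toGPFunction (hφ : M.IsCompatible ∅ φ)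
    (hK : M.HasCorank ∅ (n + 1)) : (hφ.toGPFunction hK).toStrongMatroid = M := by
  have hund : (hφ.toGPFunction hK).underlying = M.underlying := by
    refine Matroid.ext_isBase rfl fun B _ => ?_
    rw [GPFunction.underlying_isBase_iff]
    constructor
    · rintro ⟨x, hx, rfl⟩
      have := (hφ.ne_zero_iff x).1 hx
      rwa [empty_union] at this
    · intro hB
      obtain ⟨x, -, rfl⟩ := exists_tuple_of_ncard_eq (S := B) (m := n + 1) (by
        rw [hK B hB, ncard_empty, zero_add])
      exact ⟨x, (hφ.ne_zero_iff x).2 (by rwa [empty_union]), rfl⟩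
  have hsub : ∀ X ∈ M.circuits, X ∈ (hφ.toGPFunction hK).circuitSet := fun X hX =>
    ⟨by rw [hund]; exact M.isCircuit_support hX, fun y => hφ.sum_mem hK hX y⟩
  refine StrongMatroid.ext (Subset.antisymm (fun X hX => ?_) hsub)
  have hXc := hX.1
  rw [hund, underlying_isCircuit_iff] at hXc
  obtain ⟨Y, hY, hYX⟩ := hXc
  obtain ⟨α, rfl⟩ := GPFunction.eq_smul_of_mem_circuitSet hX (hsub Y hY) hYX.ge
  exact M.smul_mem Y hY α

end Orthogonality

end StrongMatroid

/-! ### The bijection -/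

namespace GPFunction

variable {G : Type u} [CommGroup G] {F : Tract G} {E : Type v} [Fintype E] {n : ℕ}

/-- The ratio property is two-term orthogonality against the common part of the two adjacent tuples.
It makes the uniqueness of compatible functions applicable to `φ`. -/
theorem isCompatible (φ : GPFunction F E n) : φ.toStrongMatroid.IsCompatible ∅ φ.toFun where
  antisymm := φ.isAntisymm
  ne_zero_iff x := by rw [underlying_toStrongMatroid, empty_union, φ.ne_zero_iff]
  ratio X hX x x' i hxx' hi hx hx' hXs := by
    have hy : x' ∘ i.succAbove = x ∘ i.succAbove :=
      funext fun j => (hxx' _ (Fin.succAbove_ne i j)).symm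
    have hmem : ∀ {z : Fin (n + 1) → E} {e}, e ∈ range z → e ≠ z i →
        e ∈ range (z ∘ i.succAbove) := by
      rintro z _ ⟨j, rfl⟩ hj
      obtain ⟨j, rfl⟩ := Fin.exists_succAbove_eq (show j ≠ i by rintro rfl; exact hj rfl)
      exact ⟨j, rfl⟩
    have h := hX.2.eq_neg (y := x ∘ i.succAbove) hi (by
      intro e he he' hXe
      apply φ.toFun_cons_eq_zero
      rcases hXs hXe with (h | h) | h
      · exact absurd h (notMem_empty e)
      · exact hmem h he
      · rw [← hy]; exact hmem h he')
    rw [φ.isAntisymm.cons_succAbove, ← hy, φ.isAntisymm.cons_succAbove, Tract.neg,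
      mul_left_comm, mul_left_comm (X (x' i)), mul_left_comm (F.eps : WithZero G)] at h
    exact mul_left_cancel₀ (F.sign_ne_zero _) h

theorem hasCorank_toStrongMatroid (φ : GPFunction F E n) :
    φ.toStrongMatroid.HasCorank ∅ (n + 1) := by
  intro B hB
  rw [underlying_toStrongMatroid] at hB
  rw [φ.ncard_of_isBase hB, ncard_empty, zero_add]

/-- Functions with the same matroid are both compatible with it, hence proportional; conversely,
rescaling by a unit changes neither the bases nor orthogonality. -/
theorem toStrongMatroid_eq_iff {φ ψ : GPFunction F E n} :
    φ.toStrongMatroid = ψ.toStrongMatroid ↔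
      ∃ g : G, ∀ x, φ.toFun x = (g : WithZero G) * ψ.toFun x := by
  constructor
  · intro h
    exact φ.isCompatible.exists_eq_mul (h ▸ ψ.isCompatible) (Matroid.empty_indep _)
      φ.hasCorank_toStrongMatroid
  · rintro ⟨g, hg⟩
    have hne : ∀ x, φ.toFun x ≠ 0 ↔ ψ.toFun x ≠ 0 := fun x => by simp [hg]
    have hund : φ.underlying = ψ.underlying := by
      refine Matroid.ext_isBase rfl fun B _ => ?_
      simp only [underlying_isBase_iff, hne]
    refine StrongMatroid.ext (Set.ext fun X => and_congr (by rw [hund]) (forall_congr' fun y => ?_))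
    have hsum : ∀ e, Tract.formal (X e * φ.toFun (Fin.cons e y)) =
        Tract.formal (g : WithZero G) * Tract.formal (X e * ψ.toFun (Fin.cons e y)) := fun e => by
      rw [hg, mul_left_comm, map_mul]
    simp only [hsum]
    rw [← Finset.mul_sum, F.formal_mul_mem_iff WithZero.coe_ne_zero]

end GPFunction

theorem theorem3p7 {G : Type u} [CommGroup G] (F : Tract G) (E : Type v) [Finite E] [Nonempty E]
    (n : ℕ) :
    ∃ Φ : GPClass F E n ≃ {M : StrongMatroid F E // M.rank = ((n + 1 : ℕ) : ℕ∞)},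
      ∀ φ : GPFunction F E n,
        (Φ (Quotient.mk _ φ)).1.underlying = φ.underlying ∧
        ∀ (X : E → WithZero G) (x₀ : E) (x : Fin (n + 1) → E),
          φ.underlying.IsCircuit (Function.support X) → x₀ ∈ Function.support X →
          φ.toFun x ≠ 0 → Function.support X \ {x₀} ⊆ Set.range x →
          (X ∈ (Φ (Quotient.mk _ φ)).1.circuits ↔
            ∀ i : Fin (n + 1), X (x i) / X x₀ =
              F.sign ((i : ℕ) + 1) *
                (φ.toFun ((Fin.cons x₀ x : Fin (n + 2) → E) ∘ i.succ.succAbove) /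
                  φ.toFun x)) := by
  cases nonempty_fintype E
  let Ψ : GPClass F E n → {M : StrongMatroid F E // M.rank = ((n + 1 : ℕ) : ℕ∞)} :=
    Quotient.lift (fun φ => ⟨φ.toStrongMatroid, φ.rank_toStrongMatroid⟩)
      fun _ _ h => Subtype.ext (GPFunction.toStrongMatroid_eq_iff.2 h)
  have hΨ : Function.Bijective Ψ := by
    constructor
    · intro a b
      induction a using Quotient.inductionOn
      induction b using Quotient.inductionOn
      exact fun h => Quotient.sound (GPFunction.toStrongMatroid_eq_iff.1 (congrArg Subtype.val h))
    · rintro ⟨M, hM⟩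
      have hK : M.HasCorank ∅ (n + 1) := by
        intro B hB
        have := hB.encard_eq_eRank.trans hM
        rw [ncard_empty, zero_add, ncard_def, this, ENat.toNat_natCast]
      obtain ⟨φ, hφ⟩ := StrongMatroid.exists_isCompatible n M.underlying.empty_indep hK
      exact ⟨Quotient.mk _ (hφ.toGPFunction hK),
        Subtype.ext (hφ.toStrongMatroid_toGPFunction hK)⟩
  refine ⟨Equiv.ofBijective Ψ hΨ, fun φ => ⟨φ.underlying_toStrongMatroid, ?_⟩⟩
  intro X x₀ x hX hx₀ hx hXx
  exact ⟨fun h => GPFunction.div_eq_of_mem_circuitSet h hx₀ hx hXx,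
    fun h => GPFunction.mem_circuitSet_of_div_eq hX hx₀ hx hXx h⟩
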